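/- Let $p,m,n,q$ be positive integers, let $A,C\in\mathbb{C}^{p\times m}$ and $B,D\in\mathbb{C}^{n\times q}$, and consider the generalized Sylvester equation $$AXB-CXD=E \qquad (*)$$ with right-hand side $E\in\mathbb{C}^{p\times q}$ and unknown $X\in\mathbb{C}^{m\times n}$. Terminology. The Kronecker canonical form (KCF) of a pencil $M-\lambda N$ is the direct sum of blocks, unique up to their order, that has the form $P(M-\lambda N)Q$ with constant invertible $P,Q$. The blocks are: right singular blocks $L_\varepsilon$ ($\varepsilon\ge 0$), the $\varepsilon\times(\varepsilon+1)$ pencil with $-\lambda$ on the main diagonal, $1$ on the first superdiagonal and $0$ elsewhere; left singular blocks $L_\eta^\top$ ($\eta\ge 0$), of size $(\eta+1)\times\eta$; Jordan blocks $J_k(\alpha)-\lambda I_k$ with $\alpha\in\mathbb{C}$, $k\ge1$; and infinite Jordan blocks $I_k-\lambda J_k(0)$, $k\ge 1$. Here $J_k(\alpha)$ has $\alpha$ on the main diagonal and $1$ on the first superdiagonal. A number $\alpha\in\mathbb{C}$ is an eigenvalue of the (possibly singular) pencil $M-\lambda N$ if $\operatorname{rank}(M-\alpha N)<\max_{\mu\in\mathbb{C}}\operatorname{rank}(M-\mu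 N)$, and $\infty$ is an eigenvalue if $\operatorname{rank}N<\max_{\mu\in\mathbb{C}}\operatorname{rank}(M-\mu N)$. The pencil is regular if it is square and $\det(M-\lambda N)$ is not the zero polynomial. "Common eigenvalue" refers to eigenvalues in $\mathbb{C}\cup\{\infty\}$. **(SR)** Equation $(*)$ has at least one solution for every right-hand side $E$ if and only if both of the following conditions hold: - the pencils $A-\lambda C$ and $D^\top-\lambda B^\top$ have no common eigenvalues, and - for every $\eta\ge0$, if the KCF of one of $A-\lambda C$, $D^\top-\lambda B^\top$ contains a block $L_\eta^\top$, then the KCF of the other pencil is a direct sum of blocks $L_{\varepsilon_i}$ with all $\varepsilon_i\le\eta$. **(OR)** Equation $(*)$ has at most one solution for every right-hand side $E$ if and only if both of the following conditions hold: - the pencils $A-\lambda C$ and $D^\top-\lambda B^\top$ have no common eigenvalues, and - for every $\varepsilon\ge0$, if the KCF of one of $A-\lambda C$, $D^\top-\lambda B^\top$ contains a block $L_\varepsilon$, then the KCF of the other pencil is a direct sum of blocks $L_{\eta_i}^\top$ with all $\eta_i\le\varepsilon$. **(UR)** Equation $(*)$ has exactly one solution for every right-hand side $E$ if and only if one of the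 following situations holds: - the pencils $A-\lambda C$ and $D^\top-\lambda B^\top$ are both regular and have no common eigenvalues, or - there is an integer $s\ge1$ such that the KCF of one of $A-\lambda C$, $D^\top-\lambda B^\top$ is a direct sum of blocks $L_s$ and the KCF of the other is a direct sum of blocks $L_s^\top$. -/

import Mathlib

namespace MatrixPencil

/-! A matrix pencil `A - λ C` is given by its pair of complex coefficient matrices `A`, `C`. -/

/-- The value of the pencil `A - λ C` at a point of `ℂ ∪ {∞}`: the matrix `A - z C` at a finite
point `z`, and the leading coefficient `C` at `∞` (the sign is irrelevant for ranks). -/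
noncomputable def evalAt {ι κ : Type} (A C : Matrix ι κ ℂ) (α : OnePoint ℂ) : Matrix ι κ ℂ :=
  OnePoint.elim α C (fun z => A - z • C)

/-- `α ∈ ℂ ∪ {∞}` is an eigenvalue of the (possibly singular) pencil `A - λ C`: the rank of the
pencil at `α` is smaller than its generic rank, i.e. smaller than its rank at some other point. -/
def IsEigenvalue {ι κ : Type} [Fintype κ] (A C : Matrix ι κ ℂ) (α : OnePoint ℂ) : Prop :=
  ∃ μ : ℂ, (evalAt A C α).rank < (A - μ • C).rank

/-- Two pencils, `A₁ - λ C₁` and `A₂ - λ C₂`, have no common eigenvalue in `ℂ ∪ {∞}`. -/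
def NoCommonEigenvalue {ι₁ κ₁ ι₂ κ₂ : Type} [Fintype κ₁] [Fintype κ₂]
    (A₁ C₁ : Matrix ι₁ κ₁ ℂ) (A₂ C₂ : Matrix ι₂ κ₂ ℂ) : Prop :=
  ∀ α : OnePoint ℂ, ¬ (IsEigenvalue A₁ C₁ α ∧ IsEigenvalue A₂ C₂ α)

/-- The pencil `A - λ C` as a matrix of polynomials in `λ`. -/
noncomputable def polyMatrix {ι κ : Type} (A C : Matrix ι κ ℂ) :
    Matrix ι κ (Polynomial ℂ) :=
  Matrix.of fun i j => Polynomial.C (A i j) - Polynomial.X * Polynomial.C (C i j)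

/-- A pencil is regular if it is square and its determinant is not the zero polynomial. -/
def IsRegular {p m : ℕ} (A C : Matrix (Fin p) (Fin m) ℂ) : Prop :=
  ∃ h : p = m, ((polyMatrix A C).submatrix id (finCongr h)).det ≠ 0

/-- Strict equivalence of pencils: `P (A - λ C) Q = A' - λ C'` with constant invertible `P`, `Q`
(up to a relabelling of the rows and columns, since the index types may differ). -/
def StrictEquiv {ι κ ι' κ' : Type} [Fintype ι] [DecidableEq ι] [Fintype κ] [DecidableEq κ]
    (A C : Matrix ι κ ℂ) (A' C' : Matrix ι' κ' ℂ) : Prop :=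
  ∃ (e : ι ≃ ι') (f : κ ≃ κ') (P : Matrix ι ι ℂ) (Q : Matrix κ κ ℂ),
    IsUnit P ∧ IsUnit Q ∧
      P * A * Q = A'.submatrix e f ∧ P * C * Q = C'.submatrix e f

/-- The labels of the blocks of the Kronecker canonical form. -/
inductive KroneckerBlock : Type
  /-- The right singular block `L_ε`, of size `ε × (ε + 1)`. -/
  | right (ε : ℕ)
  /-- The left singular block `L_ηᵀ`, of size `(η + 1) × η`. -/
  | left (η : ℕ)
  /-- The Jordan block of size `k + 1` with finite eigenvalue `α`. -/
  | jordan (k : ℕ) (α : ℂ)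
  /-- The Jordan block of size `k + 1` with eigenvalue `∞`. -/
  | jordanInf (k : ℕ)

namespace KroneckerBlock

/-- The number of rows of a block. -/
def rows : KroneckerBlock → ℕ
  | right ε => ε
  | left η => η + 1
  | jordan k _ => k + 1
  | jordanInf k => k + 1

/-- The number of columns of a block. -/
def cols : KroneckerBlock → ℕ
  | right ε => ε + 1
  | left η => η
  | jordan k _ => k + 1
  | jordanInf k => k + 1

/-- The rectangular matrix with ones on the main diagonal and zeros elsewhere. -/
def diagOnes (a b : ℕ) : Matrix (Fin a) (Fin b) ℂ :=
  Matrix.of fun i j => if (j : ℕ) = (i : ℕ) then 1 else 0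

/-- The rectangular matrix with ones on the first superdiagonal and zeros elsewhere. -/
def superOnes (a b : ℕ) : Matrix (Fin a) (Fin b) ℂ :=
  Matrix.of fun i j => if (j : ℕ) = (i : ℕ) + 1 then 1 else 0

/-- The matrix `A` of a block `A - λ C`. -/
noncomputable def coeffA : (b : KroneckerBlock) → Matrix (Fin b.rows) (Fin b.cols) ℂ
  | right ε => superOnes ε (ε + 1)
  | left η => (superOnes η (η + 1)).transpose
  | jordan k α => α • diagOnes (k + 1) (k + 1) + superOnes (k + 1) (k + 1)
  | jordanInf k => diagOnes (k + 1) (k + 1)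

/-- The matrix `C` of a block `A - λ C`. Thus `L_ε` is the `ε × (ε + 1)` pencil with `-λ` on the
diagonal and `1` on the superdiagonal, a finite Jordan block is `J(α) - λ I`, and an infinite one
is `I - λ J(0)`. -/
noncomputable def coeffC : (b : KroneckerBlock) → Matrix (Fin b.rows) (Fin b.cols) ℂ
  | right ε => diagOnes ε (ε + 1)
  | left η => (diagOnes η (η + 1)).transpose
  | jordan k _ => diagOnes (k + 1) (k + 1)
  | jordanInf k => superOnes (k + 1) (k + 1)

end KroneckerBlock

/-- The direct sum of the blocks `b 0, …, b (k - 1)` is a Kronecker canonical form of `A - λ C`.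
(The Kronecker canonical form is unique up to the order of the blocks.) -/
def IsKCF {ι κ : Type} [Fintype ι] [DecidableEq ι] [Fintype κ] [DecidableEq κ]
    (A C : Matrix ι κ ℂ) {k : ℕ} (b : Fin k → KroneckerBlock) : Prop :=
  StrictEquiv A C
    (Matrix.blockDiagonal' fun i => (b i).coeffA) (Matrix.blockDiagonal' fun i => (b i).coeffC)

/-- The Kronecker canonical form of `A - λ C` contains at least one block `β`. -/
def KCFContains {ι κ : Type} [Fintype ι] [DecidableEq ι] [Fintype κ] [DecidableEq κ]
    (A C : Matrix ι κ ℂ) (β : KroneckerBlock) : Prop :=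
  ∃ (k : ℕ) (b : Fin k → KroneckerBlock), IsKCF A C b ∧ ∃ i, b i = β

/-- The Kronecker canonical form of `A - λ C` is a direct sum of blocks from the set `S`. -/
def KCFIsSumOf {ι κ : Type} [Fintype ι] [DecidableEq ι] [Fintype κ] [DecidableEq κ]
    (A C : Matrix ι κ ℂ) (S : Set KroneckerBlock) : Prop :=
  ∃ (k : ℕ) (b : Fin k → KroneckerBlock), IsKCF A C b ∧ ∀ i, b i ∈ S

end MatrixPencil

/-!
The equation `A X B - C X D = E` is `A X C'ᵀ - C X A'ᵀ = E` for the pencils `A - λ C` and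
`A' - λ C' = Dᵀ - λ Bᵀ`. In this form (`AlwaysSolvable`) it is symmetric in the two pencils, it is
compatible with strict equivalence of either pencil, and for direct sums of pencils it decouples
into one equation for each pair of summands. So everything reduces to Kronecker's theorem and to
the solution of the equation for two Kronecker blocks.

*Kronecker's theorem* (`exists_isKCF`). Pencils are treated as pairs of linear maps
`a, c : V → W`, up to isomorphism of pairs. Suppose that `c` is not injective and that
`ker a ∩ ker c = 0`. After a choice of complements, `a` is block diagonal with the identity of
`N = ker c` as one block, and the other block `a₂` is, together with the corresponding component
`c₂` of `c`, a smaller pair (`exists_bordered`). The remaining component `c₁ : V₁ → N` of `c` is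
determined up to isomorphism by its restriction to `ker c₂`, where it is injective. Hence a
decomposition of the pair `(a₂, c₂)` into blocks gives one of `(a, c)` (`bordered_iso_pi`), in which
each block of `(a₂, c₂)` has been bordered by its own kernel: `L_ε` becomes `L_{ε+1}`, an infinite
Jordan block grows by one, and other blocks stay the same; the part of `N` outside the image of
`ker c₂` contributes infinite Jordan blocks of size one. Common kernels of `a` and `c` split off
as blocks `L₀`. If `c` is injective but not surjective, the transposed pencil is used. If `c` is
bijective, the same bordering, applied to `c` and `a - α c` for an eigenvalue `α`, gives the Jordan
normal form.

*Pairs of blocks.* If both pencils have a left null vector at the same point of `ℂ ∪ {∞}`, then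
these two vectors give a linear functional that vanishes on all `A X C'ᵀ - C X A'ᵀ`
(`AlwaysSolvable.surjective_or`). This rules out common eigenvalues, and also a block `L_ηᵀ` against
anything but blocks `L_ε`; then `ε ≤ η` by a count of dimensions. In all the other cases a solution
is found row by row, or, for `L_ε` against `L_ηᵀ`, along the diagonals of `X`.

*Uniqueness* is solvability for the adjoint operator, which is the operator of the transposed
pencils; transposition interchanges the blocks `L_ε` and `L_εᵀ`. Unique solvability is the
conjunction of the two.
-/

namespace MatrixPencil

/-! ### Pairs of parallel linear maps and their borderings -/

section KroneckerModule

variable {K : Type*} [Field K]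
  {V W V' W' V'' W'' U U' : Type*}
  [AddCommGroup V] [Module K V] [AddCommGroup W] [Module K W]
  [AddCommGroup V'] [Module K V'] [AddCommGroup W'] [Module K W']
  [AddCommGroup V''] [Module K V''] [AddCommGroup W''] [Module K W'']
  [AddCommGroup U] [Module K U] [AddCommGroup U'] [Module K U']

/-- Isomorphism of pairs of parallel linear maps `a, c : V → W` and `a', c' : V' → W'`. This is the
coordinate-free form of strict equivalence of pencils. -/
def PencilIso (a c : V →ₗ[K] W) (a' c' : V' →ₗ[K] W') : Prop :=
  ∃ (φ : V ≃ₗ[K] V') (ψ : W ≃ₗ[K] W'),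
    (∀ v, ψ (a v) = a' (φ v)) ∧ (∀ v, ψ (c v) = c' (φ v))

theorem PencilIso.refl (a c : V →ₗ[K] W) : PencilIso a c a c :=
  ⟨.refl K V, .refl K W, fun _ => rfl, fun _ => rfl⟩

theorem PencilIso.symm {a c : V →ₗ[K] W} {a' c' : V' →ₗ[K] W'} (h : PencilIso a c a' c') :
    PencilIso a' c' a c := by
  obtain ⟨φ, ψ, h1, h2⟩ := h
  refine ⟨φ.symm, ψ.symm, fun v => ?_, fun v => ?_⟩
  · rw [LinearEquiv.symm_apply_eq, h1, LinearEquiv.apply_symm_apply]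
  · rw [LinearEquiv.symm_apply_eq, h2, LinearEquiv.apply_symm_apply]

theorem PencilIso.trans {a c : V →ₗ[K] W} {a' c' : V' →ₗ[K] W'} {a'' c'' : V'' →ₗ[K] W''}
    (h : PencilIso a c a' c') (h' : PencilIso a' c' a'' c'') : PencilIso a c a'' c'' := by
  obtain ⟨φ, ψ, h1, h2⟩ := h
  obtain ⟨φ', ψ', h1', h2'⟩ := h'
  exact ⟨φ.trans φ', ψ.trans ψ', fun v => by simp [h1, h1'], fun v => by simp [h2, h2']⟩

theorem PencilIso.swap {a c : V →ₗ[K] W} {a' c' : V' →ₗ[K] W'} (h : PencilIso a c a' c') :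
    PencilIso c a c' a' := by
  obtain ⟨φ, ψ, h1, h2⟩ := h
  exact ⟨φ, ψ, h2, h1⟩

theorem PencilIso.shift {a c : V →ₗ[K] W} {a' c' : V' →ₗ[K] W'} (h : PencilIso a c a' c')
    (α : K) : PencilIso (a + α • c) c (a' + α • c') c' := by
  obtain ⟨φ, ψ, h1, h2⟩ := h
  exact ⟨φ, ψ, fun v => by simp [h1, h2], h2⟩

theorem PencilIso.unshift {a c : V →ₗ[K] W} {a' c' : V' →ₗ[K] W'} (α : K)
    (h : PencilIso a c (a' + (-α) • c') c') : PencilIso (a + α • c) c a' c' := by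
  have h' := h.shift α
  rwa [add_assoc, ← add_smul, neg_add_cancel, zero_smul, add_zero] at h'

theorem PencilIso.prod {a c : V →ₗ[K] W} {a' c' : V' →ₗ[K] W'}
    {X Y X' Y' : Type*} [AddCommGroup X] [Module K X] [AddCommGroup Y] [Module K Y]
    [AddCommGroup X'] [Module K X'] [AddCommGroup Y'] [Module K Y']
    {b d : X →ₗ[K] Y} {b' d' : X' →ₗ[K] Y'}
    (h : PencilIso a c a' c') (h' : PencilIso b d b' d') :
    PencilIso (a.prodMap b) (c.prodMap d) (a'.prodMap b') (c'.prodMap d') := by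
  obtain ⟨φ, ψ, h1, h2⟩ := h
  obtain ⟨φ', ψ', h1', h2'⟩ := h'
  exact ⟨φ.prodCongr φ', ψ.prodCongr ψ', fun v => by simp [h1, h1'], fun v => by simp [h2, h2']⟩

theorem PencilIso.pi {ι : Type*} {X Y X' Y' : ι → Type*}
    [∀ i, AddCommGroup (X i)] [∀ i, Module K (X i)] [∀ i, AddCommGroup (Y i)]
    [∀ i, Module K (Y i)] [∀ i, AddCommGroup (X' i)] [∀ i, Module K (X' i)]
    [∀ i, AddCommGroup (Y' i)] [∀ i, Module K (Y' i)]
    {a c : ∀ i, X i →ₗ[K] Y i} {a' c' : ∀ i, X' i →ₗ[K] Y' i}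
    (h : ∀ i, PencilIso (a i) (c i) (a' i) (c' i)) :
    PencilIso (LinearMap.piMap a) (LinearMap.piMap c) (LinearMap.piMap a')
      (LinearMap.piMap c') := by
  choose φ ψ h1 h2 using h
  refine ⟨LinearEquiv.piCongrRight φ, LinearEquiv.piCongrRight ψ, fun v => ?_, fun v => ?_⟩
  · ext i; simp [h1]
  · ext i; simp [h2]

/-- If `f` and `g` have no common kernel, a complement of `ker f` in `V` and a complement of
`g (ker f)` in `W` can be chosen so that `g` becomes block diagonal, with the identity of `ker f`
as its first block. -/
theorem exists_bordered (g f : V →ₗ[K] W) (hinj : ∀ v, f v = 0 → g v = 0 → v = 0) :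
    ∃ (V₁ : Submodule K V) (W₁ : Submodule K W) (g₂ f₂ : V₁ →ₗ[K] W₁)
      (f₁ : V₁ →ₗ[K] LinearMap.ker f),
      PencilIso g f ((LinearMap.id : LinearMap.ker f →ₗ[K] LinearMap.ker f).prodMap g₂)
        ((f₁.prod f₂) ∘ₗ LinearMap.snd K (LinearMap.ker f) V₁) ∧
      (∀ v, f₁ v = 0 → f₂ v = 0 → v = 0) ∧
      (Function.Bijective g → Function.Bijective g₂) := by
  set N := LinearMap.ker f with hN
  have hgN : Function.Injective (g.domRestrict N) := by
    rw [injective_iff_map_eq_zero]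
    rintro ⟨v, hv⟩ h
    exact Subtype.ext (hinj v hv h)
  obtain ⟨W₁, hW⟩ := Submodule.exists_isCompl (LinearMap.range (g.domRestrict N))
  -- this complement of `N` is chosen such that `g` maps it to `W₁`
  let V₁ : Submodule K V := W₁.comap g
  have hV : IsCompl N V₁ := by
    constructor
    · rw [Submodule.disjoint_def]
      intro v hv hv'
      exact hinj v hv (Submodule.disjoint_def.1 hW.disjoint (g v) ⟨⟨v, hv⟩, rfl⟩ hv')
    · rw [codisjoint_iff, eq_top_iff]
      intro v _
      have : g v ∈ LinearMap.range (g.domRestrict N) ⊔ W₁ := by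
        rw [hW.codisjoint.eq_top]; trivial
      obtain ⟨_, ⟨k, rfl⟩, w, hw, h⟩ := Submodule.mem_sup.1 this
      refine Submodule.mem_sup.2 ⟨k, k.2, v - k, ?_, by simp⟩
      change g (v - k) ∈ W₁
      rw [map_sub, ← h]
      simpa using hw
  let e := LinearEquiv.ofInjective _ hgN
  let φ := Submodule.prodEquivOfIsCompl _ _ hV
  let ψ : (N × W₁) ≃ₗ[K] W :=
    (e.prodCongr (.refl K W₁)).trans (Submodule.prodEquivOfIsCompl _ _ hW)
  have hψ : ∀ (k : N) (w : W₁), ψ (k, w) = g k + w := fun k w => by simp [ψ, e]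
  let g₂ : V₁ →ₗ[K] W₁ := g.restrict (fun v hv => hv)
  let F : V₁ →ₗ[K] N × W₁ := ψ.symm.toLinearMap ∘ₗ f ∘ₗ V₁.subtype
  refine ⟨V₁, W₁, g₂, LinearMap.snd _ _ _ ∘ₗ F, LinearMap.fst _ _ _ ∘ₗ F,
    PencilIso.symm ⟨φ, ψ, ?_, ?_⟩, ?_, ?_⟩
  · rintro ⟨k, v⟩
    simp [hψ, φ, g₂]
  · rintro ⟨k, v⟩
    have : (((LinearMap.fst _ _ _ ∘ₗ F).prod (LinearMap.snd _ _ _ ∘ₗ F)) ∘ₗ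
      LinearMap.snd K N V₁) (k, v) = ψ.symm (f v) := rfl
    rw [this, LinearEquiv.apply_symm_apply]
    have hk : f k = 0 := k.2
    simp [φ, hk]
  · intro v h1 h2
    have : ψ.symm (f v) = 0 := Prod.ext h1 h2
    have : f v = 0 := by simpa using this
    exact Subtype.ext (Submodule.disjoint_def.1 hV.disjoint v this v.2)
  · intro hg
    constructor
    · intro x y hxy
      exact Subtype.ext (hg.1 (congrArg Subtype.val hxy))
    · rintro ⟨w, hw⟩
      obtain ⟨v, rfl⟩ := hg.2 w
      exact ⟨⟨v, hw⟩, rfl⟩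

theorem exists_factor_of_ker_le (f : V →ₗ[K] W) (h : V →ₗ[K] U) (hk : ∀ v, f v = 0 → h v = 0) :
    ∃ T : W →ₗ[K] U, ∀ v, T (f v) = h v := by
  obtain ⟨T, hT⟩ := LinearMap.exists_extend
    (((LinearMap.ker f).liftQ h hk) ∘ₗ f.quotKerEquivRange.symm.toLinearMap)
  refine ⟨T, fun v => ?_⟩
  have := LinearMap.congr_fun hT ⟨f v, v, rfl⟩
  simp only [LinearMap.comp_apply, Submodule.subtype_apply, LinearEquiv.coe_coe] at this
  rw [this, LinearMap.quotKerEquivRange_symm_apply_image f v ⟨v, rfl⟩]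
  exact Submodule.liftQ_apply _ _ _

/-- The linear automorphism `(u, x) ↦ (u + S x, x)` of `U × V`. -/
def shearEquiv (S : V →ₗ[K] U) : (U × V) ≃ₗ[K] U × V where
  toFun x := (x.1 + S x.2, x.2)
  invFun y := (y.1 - S y.2, y.2)
  map_add' x y := by
    refine Prod.ext ?_ rfl
    simp only [Prod.fst_add, Prod.snd_add, map_add]
    exact add_add_add_comm _ _ _ _
  map_smul' r x := by
    refine Prod.ext ?_ rfl
    simp only [Prod.smul_fst, Prod.smul_snd, map_smul, RingHom.id_apply, smul_add]
  left_inv x := by simp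
  right_inv y := by simp

/-- A product of two families of modules is the family of the products. -/
def piProdEquiv {ι : Type*} (X Y : ι → Type*)
    [∀ i, AddCommGroup (X i)] [∀ i, Module K (X i)] [∀ i, AddCommGroup (Y i)]
    [∀ i, Module K (Y i)] : ((∀ i, X i) × (∀ i, Y i)) ≃ₗ[K] ∀ i, X i × Y i where
  toFun x i := (x.1 i, x.2 i)
  invFun y := (fun i => (y i).1, fun i => (y i).2)
  map_add' _ _ := rfl
  map_smul' _ _ := rfl
  left_inv _ := rfl
  right_inv _ := rfl

/-- The border `f₁` only matters on `ker f`, where it is injective. So a bordered pair is the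
direct sum of the pair `(id, 0)` on some space, and of the pair bordered by any given retraction
`π` onto `ker f`. -/
theorem bordered_iso_of_retraction (g f : V →ₗ[K] W) (f₁ : V →ₗ[K] U)
    (hinj : ∀ v, f₁ v = 0 → f v = 0 → v = 0) (ι : U' →ₗ[K] V) (π : V →ₗ[K] U')
    (hι : ∀ u, f (ι u) = 0) (hπ : ∀ u, π (ι u) = u) (hr : ∀ v, f v = 0 → ι (π v) = v) :
    ∃ U₀ : Submodule K U,
      PencilIso ((LinearMap.id : U →ₗ[K] U).prodMap g) ((f₁.prod f) ∘ₗ LinearMap.snd K U V)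
        ((LinearMap.id : U₀ →ₗ[K] U₀).prodMap ((LinearMap.id : U' →ₗ[K] U').prodMap g))
        ((0 : U₀ →ₗ[K] U₀).prodMap ((π.prod f) ∘ₗ LinearMap.snd K U' V)) := by
  have hj : Function.Injective (f₁ ∘ₗ ι) := by
    rw [injective_iff_map_eq_zero]
    intro u hu
    rw [← hπ u, hinj (ι u) hu (hι u), map_zero]
  obtain ⟨U₀, hU⟩ := Submodule.exists_isCompl (LinearMap.range (f₁ ∘ₗ ι))
  obtain ⟨T, hT⟩ := exists_factor_of_ker_le f (f₁ - f₁ ∘ₗ ι ∘ₗ π) (fun v hv => by simp [hr v hv])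
  let θ : (U₀ × U') ≃ₗ[K] U :=
    ((LinearEquiv.refl K U₀).prodCongr (LinearEquiv.ofInjective _ hj)).trans
      (Submodule.prodEquivOfIsCompl _ _ hU.symm)
  have hθ : ∀ (k : U₀) (u : U'), θ (k, u) = k + f₁ (ι u) := fun k u => by simp [θ]
  -- the shear by `T` replaces `f₁` by `f₁ ∘ ι ∘ π`, which agrees with it on `ker f`
  refine ⟨U₀, PencilIso.symm
    ⟨(LinearEquiv.prodAssoc K U₀ U' V).symm.trans
      ((θ.prodCongr (.refl K V)).trans (shearEquiv (T ∘ₗ g))),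
    (LinearEquiv.prodAssoc K U₀ U' W).symm.trans
      ((θ.prodCongr (.refl K W)).trans (shearEquiv T)), ?_, ?_⟩⟩
  · rintro ⟨k, u, v⟩
    exact Prod.ext (by simp [shearEquiv, LinearEquiv.prodAssoc]) rfl
  · rintro ⟨k, u, v⟩
    exact Prod.ext (by simp [shearEquiv, LinearEquiv.prodAssoc, hT, hθ]) rfl

/-- An isomorphism of `(g, f)` transports every bordering of `(g, f)`. -/
theorem bordered_iso_congr {g f : V →ₗ[K] W} {g' f' : V' →ₗ[K] W'} (f₁ : V →ₗ[K] U)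
    (h : PencilIso g f g' f') (hinj : ∀ v, f₁ v = 0 → f v = 0 → v = 0) :
    ∃ f₁' : V' →ₗ[K] U, (∀ v, f₁' v = 0 → f' v = 0 → v = 0) ∧
      PencilIso ((LinearMap.id : U →ₗ[K] U).prodMap g) ((f₁.prod f) ∘ₗ LinearMap.snd K U V)
        ((LinearMap.id : U →ₗ[K] U).prodMap g') ((f₁'.prod f') ∘ₗ LinearMap.snd K U V') := by
  obtain ⟨φ, ψ, h1, h2⟩ := h
  refine ⟨f₁ ∘ₗ φ.symm.toLinearMap, fun v hv hv' => ?_, (LinearEquiv.refl K U).prodCongr φ,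
    (LinearEquiv.refl K U).prodCongr ψ, fun v => by simp [h1], fun v => by simp [h2]⟩
  have : φ.symm v = 0 := hinj _ hv (ψ.injective (by rw [h2]; simp [hv']))
  simpa using this

/-- The splitting step: if `(g, f)` is a direct sum of pairs `(gᵢ, fᵢ)`, then every pair obtained
by bordering `(g, f)` is a direct sum of a pair `(id, 0)` and of borderings of the `(gᵢ, fᵢ)`. -/
theorem bordered_iso_pi {ι : Type*} {X Y : ι → Type*}
    [∀ i, AddCommGroup (X i)] [∀ i, Module K (X i)] [∀ i, AddCommGroup (Y i)]
    [∀ i, Module K (Y i)] {g f : V →ₗ[K] W} (g' f' : ∀ i, X i →ₗ[K] Y i)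
    (h : PencilIso g f (LinearMap.piMap g') (LinearMap.piMap f'))
    (f₁ : V →ₗ[K] U) (hinj : ∀ v, f₁ v = 0 → f v = 0 → v = 0)
    (π : ∀ i, X i →ₗ[K] LinearMap.ker (f' i))
    (hπ : ∀ i (u : LinearMap.ker (f' i)), π i (u : X i) = u) :
    ∃ U₀ : Submodule K U,
      PencilIso ((LinearMap.id : U →ₗ[K] U).prodMap g) ((f₁.prod f) ∘ₗ LinearMap.snd K U V)
        ((LinearMap.id : U₀ →ₗ[K] U₀).prodMap (LinearMap.piMap fun i =>
          (LinearMap.id : LinearMap.ker (f' i) →ₗ[K] _).prodMap (g' i)))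
        ((0 : U₀ →ₗ[K] U₀).prodMap (LinearMap.piMap fun i =>
          ((π i).prod (f' i)) ∘ₗ LinearMap.snd K _ (X i))) := by
  obtain ⟨f₁', hinj', h1⟩ := bordered_iso_congr f₁ h hinj
  obtain ⟨U₀, h2⟩ := bordered_iso_of_retraction (LinearMap.piMap g') (LinearMap.piMap f') f₁' hinj'
    (LinearMap.piMap fun i => (LinearMap.ker (f' i)).subtype) (LinearMap.piMap π)
    (fun u => by ext i; simp) (fun u => by ext i; simp [hπ])
    (fun v hv => by
      ext i
      have hi : f' i (v i) = 0 := congrFun hv i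
      exact congrArg Subtype.val (hπ i ⟨v i, hi⟩))
  refine ⟨U₀, h1.trans (h2.trans (PencilIso.prod (.refl _ _) ?_))⟩
  exact ⟨piProdEquiv _ X, piProdEquiv _ Y, fun v => rfl, fun v => rfl⟩

end KroneckerModule

/-! ### Kronecker blocks as pairs of linear maps -/

namespace KroneckerBlock

theorem superOnes_mulVec_tail (k : ℕ) (v : Fin (k + 1) → ℂ) :
    (superOnes k (k + 1)).mulVec v = Fin.tail v := by
  ext i
  have h : ∀ j : Fin (k + 1), ((j : ℕ) = (i : ℕ) + 1) = (j = i.succ) := fun j => by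
    rw [Fin.ext_iff, Fin.val_succ]
  simp [Matrix.mulVec, dotProduct, superOnes, h, Fin.tail]

theorem diagOnes_mulVec_init (k : ℕ) (v : Fin (k + 1) → ℂ) :
    (diagOnes k (k + 1)).mulVec v = Fin.init v := by
  ext i
  have h : ∀ j : Fin (k + 1), ((j : ℕ) = (i : ℕ)) = (j = i.castSucc) := fun j => by
    rw [Fin.ext_iff, Fin.val_castSucc]
  simp [Matrix.mulVec, dotProduct, diagOnes, h, Fin.init]

theorem diagOnes_self (k : ℕ) : diagOnes k k = 1 := by
  ext i j
  simp [diagOnes, Matrix.one_apply, Fin.ext_iff, eq_comm]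

theorem superOnes_mulVec_snoc (k : ℕ) (v : Fin (k + 1) → ℂ) :
    (superOnes (k + 1) (k + 1)).mulVec v = Fin.snoc (α := fun _ => ℂ) (Fin.tail v) 0 := by
  ext i
  refine Fin.lastCases ?_ (fun i => ?_) i
  · have h : ∀ j : Fin (k + 1), ((j : ℕ) = k + 1) = False := fun j => by
      simpa using j.2.ne
    simp [Matrix.mulVec, dotProduct, superOnes, h]
  · have h : ∀ j : Fin (k + 1), ((j : ℕ) = (i : ℕ) + 1) = (j = i.succ) := fun j => by
      rw [Fin.ext_iff, Fin.val_succ]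
    simp [Matrix.mulVec, dotProduct, superOnes, h, Fin.tail]

theorem superOnes_pow_apply (k r : ℕ) (i j : Fin k) :
    (superOnes k k ^ r) i j = if (j : ℕ) = i + r then 1 else 0 := by
  induction r generalizing i j with
  | zero => simp [Matrix.one_apply, Fin.ext_iff, eq_comm]
  | succ r ih =>
    rw [pow_succ', Matrix.mul_apply]
    simp only [ih]
    simp only [superOnes, Matrix.of_apply, ite_mul, one_mul, zero_mul]
    by_cases hi : (i : ℕ) + 1 < k
    · rw [Finset.sum_eq_single ⟨(i : ℕ) + 1, hi⟩]
      · simp [add_assoc, add_comm 1 r]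
      · intro b _ hb
        rw [if_neg]
        intro h
        exact hb (Fin.ext h)
      · simp
    · rw [Finset.sum_eq_zero, if_neg]
      · have := j.2; omega
      · intro b _
        rw [if_neg]
        have := b.2; omega

theorem isNilpotent_superOnes (k : ℕ) : IsNilpotent (superOnes k k) := by
  refine ⟨k, ?_⟩
  ext i j
  rw [superOnes_pow_apply, if_neg]
  · rfl
  · have := j.2; omega

/-- A Jordan matrix `z I + J(0)` with `z ≠ 0` is invertible. -/
theorem isUnit_smul_one_add_superOnes (k : ℕ) {z : ℂ} (hz : z ≠ 0) :
    IsUnit (z • (1 : Matrix (Fin k) (Fin k) ℂ) + superOnes k k) := by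
  refine (isNilpotent_superOnes k).isUnit_add_left_of_commute ?_ ?_
  · rw [← Algebra.algebraMap_eq_smul_one]
    exact (isUnit_iff_ne_zero.2 hz).map _
  · exact (Commute.one_right _).smul_right z

end KroneckerBlock

open KroneckerBlock

/-- The linear equivalence appending a last coordinate. -/
def snocEquiv (n : ℕ) : (ℂ × (Fin n → ℂ)) ≃ₗ[ℂ] (Fin (n + 1) → ℂ) where
  toFun x := Fin.snoc (α := fun _ => ℂ) x.2 x.1
  invFun y := (y (Fin.last n), Fin.init y)
  map_add' x y := by
    ext i
    refine Fin.lastCases ?_ (fun i => ?_) i <;> simp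
  map_smul' r x := by
    ext i
    refine Fin.lastCases ?_ (fun i => ?_) i <;> simp
  left_inv x := by simp
  right_inv y := by simp

/-- The linear equivalence prepending a first coordinate. -/
def consEquiv (n : ℕ) : (ℂ × (Fin n → ℂ)) ≃ₗ[ℂ] (Fin (n + 1) → ℂ) where
  toFun x := Fin.cons (α := fun _ => ℂ) x.1 x.2
  invFun y := (y 0, Fin.tail y)
  map_add' x y := by
    ext i
    refine Fin.cases ?_ (fun i => ?_) i <;> simp
  map_smul' r x := by
    ext i
    refine Fin.cases ?_ (fun i => ?_) i <;> simp
  left_inv x := by simp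
  right_inv y := by simp

/-- The linear map of the matrix `A` of a block `A - λ C`. -/
noncomputable def blockA (β : KroneckerBlock) : (Fin β.cols → ℂ) →ₗ[ℂ] (Fin β.rows → ℂ) :=
  β.coeffA.mulVecLin

/-- The linear map of the matrix `C` of a block `A - λ C`. -/
noncomputable def blockC (β : KroneckerBlock) : (Fin β.cols → ℂ) →ₗ[ℂ] (Fin β.rows → ℂ) :=
  β.coeffC.mulVecLin

theorem blockA_right (ε : ℕ) (v : Fin (ε + 1) → ℂ) : blockA (.right ε) v = Fin.tail v :=
  superOnes_mulVec_tail ε v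

theorem blockC_right (ε : ℕ) (v : Fin (ε + 1) → ℂ) : blockC (.right ε) v = Fin.init v :=
  diagOnes_mulVec_init ε v

theorem blockA_jordan (k : ℕ) (α : ℂ) (v : Fin (k + 1) → ℂ) :
    blockA (.jordan k α) v = α • v + Fin.snoc (α := fun _ => ℂ) (Fin.tail v) 0 := by
  change (α • diagOnes (k + 1) (k + 1) + superOnes (k + 1) (k + 1)).mulVec v = _
  rw [Matrix.add_mulVec, Matrix.smul_mulVec, diagOnes_self, Matrix.one_mulVec,
    superOnes_mulVec_snoc]

theorem blockC_jordan (k : ℕ) (α : ℂ) (v : Fin (k + 1) → ℂ) : blockC (.jordan k α) v = v := by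
  change (diagOnes (k + 1) (k + 1)).mulVec v = _
  rw [diagOnes_self, Matrix.one_mulVec]

theorem blockA_jordanInf (k : ℕ) (v : Fin (k + 1) → ℂ) : blockA (.jordanInf k) v = v :=
  blockC_jordan k 0 v

theorem blockC_jordanInf (k : ℕ) (v : Fin (k + 1) → ℂ) :
    blockC (.jordanInf k) v = Fin.snoc (α := fun _ => ℂ) (Fin.tail v) 0 :=
  superOnes_mulVec_snoc k v

section SumOfBlocks

variable {V W V' W' U : Type*}
  [AddCommGroup V] [Module ℂ V] [AddCommGroup W] [Module ℂ W]
  [AddCommGroup V'] [Module ℂ V'] [AddCommGroup W'] [Module ℂ W']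
  [AddCommGroup U] [Module ℂ U]

/-- The pair `a, c : V → W` is isomorphic to a finite direct sum of Kronecker blocks from `S`. -/
def IsSumOfBlocks (S : Set KroneckerBlock) (a c : V →ₗ[ℂ] W) : Prop :=
  ∃ (ι : Type) (_ : Fintype ι) (b : ι → KroneckerBlock), (∀ i, b i ∈ S) ∧
    PencilIso a c (LinearMap.piMap fun i => blockA (b i)) (LinearMap.piMap fun i => blockC (b i))

theorem IsSumOfBlocks.of_iso {S : Set KroneckerBlock} {a c : V →ₗ[ℂ] W} {a' c' : V' →ₗ[ℂ] W'}
    (h' : IsSumOfBlocks S a' c') (h : PencilIso a c a' c') : IsSumOfBlocks S a c := by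
  obtain ⟨ι, hι, b, hb, hi⟩ := h'
  exact ⟨ι, hι, b, hb, h.trans hi⟩

theorem isSumOfBlocks_of_subsingleton [Subsingleton V] [Subsingleton W] (S : Set KroneckerBlock)
    (a c : V →ₗ[ℂ] W) : IsSumOfBlocks S a c :=
  ⟨Empty, inferInstance, Empty.elim, fun i => i.elim, 0, 0,
    fun _ => Subsingleton.elim _ _, fun _ => Subsingleton.elim _ _⟩

theorem IsSumOfBlocks.pi {S : Set KroneckerBlock} {ι : Type} [Fintype ι] {X Y : ι → Type*}
    [∀ i, AddCommGroup (X i)] [∀ i, Module ℂ (X i)] [∀ i, AddCommGroup (Y i)]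
    [∀ i, Module ℂ (Y i)] {a c : ∀ i, X i →ₗ[ℂ] Y i} (h : ∀ i, IsSumOfBlocks S (a i) (c i)) :
    IsSumOfBlocks S (LinearMap.piMap a) (LinearMap.piMap c) := by
  choose κ hκ b hb hi using h
  refine ⟨Σ i, κ i, inferInstance, fun x => b x.1 x.2, fun x => hb x.1 x.2,
    (PencilIso.pi hi).trans (PencilIso.symm ⟨
      LinearEquiv.piCurry ℂ (fun i j => Fin (b i j).cols → ℂ),
      LinearEquiv.piCurry ℂ (fun i j => Fin (b i j).rows → ℂ), fun v => rfl, fun v => rfl⟩)⟩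

theorem IsSumOfBlocks.prod {S : Set KroneckerBlock} {a c : V →ₗ[ℂ] W} {a' c' : V' →ₗ[ℂ] W'}
    (h : IsSumOfBlocks S a c) (h' : IsSumOfBlocks S a' c') :
    IsSumOfBlocks S (a.prodMap a') (c.prodMap c') := by
  obtain ⟨ι, _, b, hb, hi⟩ := h
  obtain ⟨ι', _, b', hb', hi'⟩ := h'
  refine ⟨ι ⊕ ι', inferInstance, Sum.elim b b', Sum.rec hb hb',
    (hi.prod hi').trans (PencilIso.symm ⟨
      LinearEquiv.sumPiEquivProdPi ℂ ι ι' (fun i => Fin (Sum.elim b b' i).cols → ℂ),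
      LinearEquiv.sumPiEquivProdPi ℂ ι ι' (fun i => Fin (Sum.elim b b' i).rows → ℂ),
      fun v => rfl, fun v => rfl⟩)⟩

theorem isSumOfBlocks_single {S : Set KroneckerBlock} {β : KroneckerBlock} (hβ : β ∈ S)
    {a c : V →ₗ[ℂ] W} (h : PencilIso a c (blockA β) (blockC β)) : IsSumOfBlocks S a c :=
  ⟨Unit, inferInstance, fun _ => β, fun _ => hβ, h.trans (PencilIso.symm
    ⟨LinearEquiv.funUnique Unit ℂ (Fin β.cols → ℂ), LinearEquiv.funUnique Unit ℂ (Fin β.rows → ℂ),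
      fun _ => rfl, fun _ => rfl⟩)⟩

/-- A pair of scalar multiples of the identity splits into one-dimensional pairs. -/
theorem isSumOfBlocks_scalar [FiniteDimensional ℂ U] {S : Set KroneckerBlock} (x y : ℂ)
    (h : IsSumOfBlocks S (x • LinearMap.id : ℂ →ₗ[ℂ] ℂ) (y • LinearMap.id)) :
    IsSumOfBlocks S (x • LinearMap.id : U →ₗ[ℂ] U) (y • LinearMap.id) := by
  let e := (Module.finBasis ℂ U).equivFun
  exact (IsSumOfBlocks.pi fun _ : Fin (Module.finrank ℂ U) => h).of_iso
    ⟨e, e, fun v => by ext; simp, fun v => by ext; simp⟩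

theorem snoc_tail_zero_of_fin_one (v : Fin 1 → ℂ) :
    (Fin.snoc (α := fun _ => ℂ) (Fin.tail v) 0 : Fin 1 → ℂ) = 0 := by
  funext i
  rw [Subsingleton.elim (α := Fin 1) i (Fin.last 0), Fin.snoc_last]
  rfl

/-- The pair `(id, 0)` is a sum of infinite Jordan blocks of size one. -/
theorem isSumOfBlocks_id_zero [FiniteDimensional ℂ U] :
    IsSumOfBlocks Set.univ (LinearMap.id : U →ₗ[ℂ] U) 0 := by
  let e : ℂ ≃ₗ[ℂ] (Fin 1 → ℂ) := (LinearEquiv.funUnique (Fin 1) ℂ ℂ).symm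
  have h : PencilIso ((1 : ℂ) • LinearMap.id : ℂ →ₗ[ℂ] ℂ) ((0 : ℂ) • LinearMap.id)
      (blockA (.jordanInf 0)) (blockC (.jordanInf 0)) :=
    ⟨e, e, fun v => (by simp : e _ = e v).trans (blockA_jordanInf 0 _).symm,
      fun v => (by simp : e _ = 0).trans
        ((blockC_jordanInf 0 _).trans (snoc_tail_zero_of_fin_one _)).symm⟩
  simpa using isSumOfBlocks_scalar (U := U) (S := Set.univ) 1 0
    (isSumOfBlocks_single (Set.mem_univ _) h)

/-- The Jordan blocks with finite eigenvalues. -/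
def jordanBlocks : Set KroneckerBlock := {β | ∃ k α, β = .jordan k α}

theorem jordan_mem_jordanBlocks (k : ℕ) (α : ℂ) : .jordan k α ∈ jordanBlocks := ⟨k, α, rfl⟩

theorem isSumOfBlocks_smul_id_id [FiniteDimensional ℂ U] (α : ℂ) :
    IsSumOfBlocks jordanBlocks (α • LinearMap.id : U →ₗ[ℂ] U) LinearMap.id := by
  let e : ℂ ≃ₗ[ℂ] (Fin 1 → ℂ) := (LinearEquiv.funUnique (Fin 1) ℂ ℂ).symm
  have h : PencilIso (α • LinearMap.id : ℂ →ₗ[ℂ] ℂ) ((1 : ℂ) • LinearMap.id)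
      (blockA (.jordan 0 α)) (blockC (.jordan 0 α)) :=
    ⟨e, e, fun v => (map_smul e α v).trans ((blockA_jordan 0 α (e v)).trans
      (by rw [snoc_tail_zero_of_fin_one, add_zero] : _ = α • e v)).symm,
      fun v => (by simp : e _ = e v).trans (blockC_jordan 0 α _).symm⟩
  simpa using isSumOfBlocks_scalar (U := U) (S := jordanBlocks) α 1
    (isSumOfBlocks_single (jordan_mem_jordanBlocks 0 α) h)

/-- A pair of maps to the zero space is a sum of blocks `L₀`. -/
theorem isSumOfBlocks_of_subsingleton_right [FiniteDimensional ℂ V] [Subsingleton W]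
    (a c : V →ₗ[ℂ] W) : IsSumOfBlocks Set.univ a c := by
  have h0 : IsSumOfBlocks Set.univ (0 : ℂ →ₗ[ℂ] (Fin 0 → ℂ)) 0 :=
    isSumOfBlocks_single (β := .right 0) (Set.mem_univ _) ⟨(LinearEquiv.funUnique (Fin 1) ℂ ℂ).symm,
      .refl ℂ _, fun _ => funext fun i => i.elim0, fun _ => funext fun i => i.elim0⟩
  let e := (Module.finBasis ℂ V).equivFun
  exact (IsSumOfBlocks.pi fun _ : Fin (Module.finrank ℂ V) => h0).of_iso
    ⟨e, 0, fun _ => Subsingleton.elim _ _, fun _ => Subsingleton.elim _ _⟩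

/-- `(g, f)` bordered by a retraction onto a trivial kernel is `(g, f)` itself. -/
theorem exists_retraction_of_injective (g f : V →ₗ[ℂ] W) (hf : Function.Injective f) :
    ∃ π : V →ₗ[ℂ] LinearMap.ker f, (∀ u : LinearMap.ker f, π (u : V) = u) ∧
      PencilIso ((LinearMap.id : LinearMap.ker f →ₗ[ℂ] LinearMap.ker f).prodMap g)
        ((π.prod f) ∘ₗ LinearMap.snd ℂ (LinearMap.ker f) V) g f := by
  have hs : Subsingleton (LinearMap.ker f) := by
    rw [LinearMap.ker_eq_bot.2 hf]
    infer_instance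
  refine ⟨0, fun u => Subsingleton.elim _ _, ?_⟩
  have := Unique.mk' (LinearMap.ker f)
  exact PencilIso.symm ⟨(LinearEquiv.uniqueProd (R := ℂ) (M₂ := LinearMap.ker f)).symm,
    (LinearEquiv.uniqueProd (R := ℂ) (M₂ := LinearMap.ker f)).symm,
    fun v => Prod.ext (Subsingleton.elim _ _) rfl, fun v => Prod.ext (Subsingleton.elim _ _) rfl⟩

/-- `(g, f)` bordered by a retraction `v ↦ ℓ v • u` onto a kernel spanned by `u`, in
coordinates. -/
theorem exists_retraction_of_ker_eq_span (g f : V →ₗ[ℂ] W) (u : V) (ℓ : V →ₗ[ℂ] ℂ)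
    (hu : f u = 0) (hℓ : ℓ u = 1) (hker : ∀ v, f v = 0 → ℓ v • u = v) :
    ∃ π : V →ₗ[ℂ] LinearMap.ker f, (∀ u : LinearMap.ker f, π (u : V) = u) ∧
      PencilIso ((LinearMap.id : LinearMap.ker f →ₗ[ℂ] LinearMap.ker f).prodMap g)
        ((π.prod f) ∘ₗ LinearMap.snd ℂ (LinearMap.ker f) V)
        ((LinearMap.id : ℂ →ₗ[ℂ] ℂ).prodMap g) ((ℓ.prod f) ∘ₗ LinearMap.snd ℂ ℂ V) := by
  let e : ℂ ≃ₗ[ℂ] LinearMap.ker f :=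
    { toFun := fun z => ⟨z • u, by simp [hu]⟩
      invFun := fun v => ℓ v
      map_add' := fun x y => Subtype.ext (add_smul x y u)
      map_smul' := fun x y => Subtype.ext (mul_smul x y u)
      left_inv := fun z => by simp [hℓ]
      right_inv := fun v => Subtype.ext (hker v v.2) }
  refine ⟨e.toLinearMap ∘ₗ ℓ, fun v => Subtype.ext (hker v v.2), PencilIso.symm
    ⟨e.prodCongr (.refl ℂ V), e.prodCongr (.refl ℂ W), fun v => rfl, fun v => rfl⟩⟩

/-- The Jordan chain with eigenvalue `0`, bordered by its kernel, is the Jordan chain that is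
longer by one. -/
theorem exists_retraction_of_chain (k : ℕ) (g f : (Fin (k + 1) → ℂ) →ₗ[ℂ] (Fin (k + 1) → ℂ))
    (hg : ∀ v, g v = v) (hf : ∀ v, f v = Fin.snoc (α := fun _ => ℂ) (Fin.tail v) 0)
    (g' f' : (Fin (k + 2) → ℂ) →ₗ[ℂ] (Fin (k + 2) → ℂ))
    (hg' : ∀ v, g' v = v) (hf' : ∀ v, f' v = Fin.snoc (α := fun _ => ℂ) (Fin.tail v) 0) :
    ∃ π : (Fin (k + 1) → ℂ) →ₗ[ℂ] LinearMap.ker f,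
      (∀ u : LinearMap.ker f, π (u : Fin (k + 1) → ℂ) = u) ∧
      PencilIso ((LinearMap.id : LinearMap.ker f →ₗ[ℂ] LinearMap.ker f).prodMap g)
        ((π.prod f) ∘ₗ LinearMap.snd ℂ (LinearMap.ker f) _) g' f' := by
  obtain ⟨π, hπ, h⟩ := exists_retraction_of_ker_eq_span g f (Fin.cons 1 0)
    (LinearMap.proj 0) (by
      rw [hf]
      ext i
      refine Fin.lastCases ?_ (fun i => ?_) i <;> simp) (by simp) (fun v hv => by
      rw [hf] at hv
      ext i
      refine Fin.cases ?_ (fun i => ?_) i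
      · simp
      · have := congrFun hv i.castSucc
        simp only [Fin.snoc_castSucc, Fin.tail] at this
        simp [this])
  refine ⟨π, hπ, h.trans ⟨consEquiv (k + 1), consEquiv (k + 1), ?_, ?_⟩⟩
  · rintro ⟨z, v⟩
    simp [hg, hg']
  · rintro ⟨z, v⟩
    have hz : Fin.tail (consEquiv (k + 1) (z, v)) = v := Fin.tail_cons (α := fun _ => ℂ) z v
    rw [hf', hz]
    change Fin.cons (α := fun _ => ℂ) (v 0) (f v) = _
    rw [hf, Fin.cons_snoc_eq_snoc_cons]
    exact congrArg (fun w => Fin.snoc (α := fun _ => ℂ) w (0 : ℂ)) (Fin.cons_self_tail v)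

/-- The block `L_ε`, bordered by its kernel at infinity, is `L_{ε+1}`. -/
theorem exists_retraction_of_right (k : ℕ) (g f : (Fin (k + 1) → ℂ) →ₗ[ℂ] (Fin k → ℂ))
    (hg : ∀ v, g v = Fin.tail v) (hf : ∀ v, f v = Fin.init v)
    (g' f' : (Fin (k + 2) → ℂ) →ₗ[ℂ] (Fin (k + 1) → ℂ))
    (hg' : ∀ v, g' v = Fin.tail v) (hf' : ∀ v, f' v = Fin.init v) :
    ∃ π : (Fin (k + 1) → ℂ) →ₗ[ℂ] LinearMap.ker f,
      (∀ u : LinearMap.ker f, π (u : Fin (k + 1) → ℂ) = u) ∧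
      PencilIso ((LinearMap.id : LinearMap.ker f →ₗ[ℂ] LinearMap.ker f).prodMap g)
        ((π.prod f) ∘ₗ LinearMap.snd ℂ (LinearMap.ker f) _) g' f' := by
  obtain ⟨π, hπ, h⟩ := exists_retraction_of_ker_eq_span g f
    (Fin.snoc (α := fun _ => ℂ) 0 1) (LinearMap.proj (Fin.last k)) (by rw [hf, Fin.init_snoc])
    (by simp) (fun v hv => by
      rw [hf] at hv
      ext i
      refine Fin.lastCases ?_ (fun i => ?_) i
      · simp
      · have := congrFun hv i
        simp only [Fin.init] at this
        simp [this])
  refine ⟨π, hπ, h.trans ⟨snocEquiv (k + 1), snocEquiv k, ?_, ?_⟩⟩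
  · rintro ⟨z, v⟩
    rw [hg']
    change Fin.snoc (α := fun _ => ℂ) (g v) z = Fin.tail (Fin.snoc (α := fun _ => ℂ) v z)
    rw [hg]
    ext i
    refine Fin.lastCases ?_ (fun i => ?_) i
    · simp [Fin.tail, Fin.succ_last]
    · simp only [Fin.tail, Fin.succ_castSucc, Fin.snoc_castSucc]
  · rintro ⟨z, v⟩
    rw [hf']
    change Fin.snoc (α := fun _ => ℂ) (f v) (v (Fin.last k)) =
      Fin.init (Fin.snoc (α := fun _ => ℂ) v z)
    rw [hf, Fin.snoc_init_self, Fin.init_snoc]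

theorem blockC_left_injective (η : ℕ) : Function.Injective (blockC (.left η)) := by
  intro (x : Fin η → ℂ) (y : Fin η → ℂ) h
  have key : ∀ v : Fin η → ℂ, ∀ i : Fin η,
      (diagOnes η (η + 1)).transpose.mulVec v i.castSucc = v i := fun v i => by
    have h : ∀ j : Fin η, ((i : ℕ) = (j : ℕ)) = (i = j) := fun j => by rw [Fin.ext_iff]
    simp [Matrix.mulVec, dotProduct, diagOnes, h]
  funext i
  rw [← key x, ← key y]
  exact congrFun h i.castSucc

/-- A Jordan block is injective at every point other than its eigenvalue. -/
theorem blockA_sub_injective (k : ℕ) {γ α : ℂ} (h : γ ≠ α) :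
    Function.Injective (blockA (.jordan k γ) + (-α) • blockC (.jordan k γ)) := by
  have hM : blockA (.jordan k γ) + (-α) • blockC (.jordan k γ) =
      ((γ - α) • (1 : Matrix (Fin (k + 1)) (Fin (k + 1)) ℂ) +
        superOnes (k + 1) (k + 1)).mulVecLin := by
    have key : ∀ v : Fin (k + 1) → ℂ,
        (γ • diagOnes (k + 1) (k + 1) + superOnes (k + 1) (k + 1)).mulVec v +
          (-α) • (diagOnes (k + 1) (k + 1)).mulVec v =
        ((γ - α) • (1 : Matrix (Fin (k + 1)) (Fin (k + 1)) ℂ) +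
          superOnes (k + 1) (k + 1)).mulVec v := fun v => by
      rw [diagOnes_self, ← Matrix.smul_mulVec, ← Matrix.add_mulVec]
      congr 1
      module
    exact LinearMap.ext key
  rw [hM]
  exact Matrix.mulVec_injective_iff_isUnit.2 (isUnit_smul_one_add_superOnes _ (sub_ne_zero.2 h))

/-- Every Kronecker block, bordered by the kernel of its second map, is again a block: `L_ε` and
the infinite Jordan blocks grow by one, the other blocks do not change. -/
theorem exists_retraction_block (β : KroneckerBlock) :
    ∃ π : (Fin β.cols → ℂ) →ₗ[ℂ] LinearMap.ker (blockC β),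
      (∀ u : LinearMap.ker (blockC β), π (u : Fin β.cols → ℂ) = u) ∧
      IsSumOfBlocks Set.univ
        ((LinearMap.id : LinearMap.ker (blockC β) →ₗ[ℂ] _).prodMap (blockA β))
        ((π.prod (blockC β)) ∘ₗ LinearMap.snd ℂ (LinearMap.ker (blockC β)) _) := by
  cases β with
  | right ε =>
    obtain ⟨π, hπ, h⟩ := exists_retraction_of_right ε (blockA (.right ε)) (blockC (.right ε))
      (blockA_right ε) (blockC_right ε) (blockA (.right (ε + 1))) (blockC (.right (ε + 1)))
      (blockA_right (ε + 1)) (blockC_right (ε + 1))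
    exact ⟨π, hπ, isSumOfBlocks_single (S := Set.univ) (β := .right (ε + 1)) (Set.mem_univ _) h⟩
  | left η =>
    obtain ⟨π, hπ, h⟩ := exists_retraction_of_injective (blockA (.left η)) (blockC (.left η))
      (blockC_left_injective η)
    exact ⟨π, hπ, isSumOfBlocks_single (Set.mem_univ _) h⟩
  | jordan k α =>
    obtain ⟨π, hπ, h⟩ := exists_retraction_of_injective (blockA (.jordan k α))
      (blockC (.jordan k α)) (fun x y h => by
        exact (blockC_jordan k α x).symm.trans (h.trans (blockC_jordan k α y)))
    exact ⟨π, hπ, isSumOfBlocks_single (Set.mem_univ _) h⟩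
  | jordanInf k =>
    obtain ⟨π, hπ, h⟩ := exists_retraction_of_chain k (blockA (.jordanInf k))
      (blockC (.jordanInf k)) (blockA_jordanInf k) (blockC_jordanInf k)
      (blockA (.jordanInf (k + 1))) (blockC (.jordanInf (k + 1)))
      (blockA_jordanInf (k + 1)) (blockC_jordanInf (k + 1))
    exact ⟨π, hπ, isSumOfBlocks_single (S := Set.univ) (β := .jordanInf (k + 1)) (Set.mem_univ _) h⟩

/-- The analogue of `exists_retraction_block` at a finite point `α`. -/
theorem exists_retraction_jordan {β : KroneckerBlock} (hβ : β ∈ jordanBlocks) (α : ℂ) :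
    ∃ π : (Fin β.cols → ℂ) →ₗ[ℂ] LinearMap.ker (blockA β + (-α) • blockC β),
      (∀ u : LinearMap.ker (blockA β + (-α) • blockC β), π (u : Fin β.cols → ℂ) = u) ∧
      IsSumOfBlocks jordanBlocks
        ((π.prod (blockA β + (-α) • blockC β)) ∘ₗ LinearMap.snd ℂ
            (LinearMap.ker (blockA β + (-α) • blockC β)) _ +
          α • (LinearMap.id : LinearMap.ker (blockA β + (-α) • blockC β) →ₗ[ℂ] _).prodMap
            (blockC β))
        ((LinearMap.id : LinearMap.ker (blockA β + (-α) • blockC β) →ₗ[ℂ] _).prodMap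
            (blockC β)) := by
  obtain ⟨k, γ, rfl⟩ := hβ
  by_cases h : γ = α
  · subst h
    have key : ∀ (k : ℕ) (v : Fin (k + 1) → ℂ), (blockA (.jordan k γ) +
        (-γ) • blockC (.jordan k γ)) v = Fin.snoc (α := fun _ => ℂ) (Fin.tail v) 0 := by
      intro k v
      have h1 := blockA_jordan k γ v
      have h2 : ((-γ) • blockC (.jordan k γ)) v = (-γ) • v :=
        congrArg (fun w => (-γ) • w) (blockC_jordan k γ v)
      refine (congrArg₂ (· + ·) h1 h2).trans ?_
      change (γ • v + Fin.snoc (α := fun _ => ℂ) (Fin.tail v) 0) + (-γ) • v = _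
      module
    obtain ⟨π, hπ, h⟩ := exists_retraction_of_chain k (blockC (.jordan k γ))
      (blockA (.jordan k γ) + (-γ) • blockC (.jordan k γ)) (blockC_jordan k γ) (key k)
      (blockC (.jordan (k + 1) γ))
      (blockA (.jordan (k + 1) γ) + (-γ) • blockC (.jordan (k + 1) γ)) (blockC_jordan (k + 1) γ)
      (key (k + 1))
    exact ⟨π, hπ, isSumOfBlocks_single (jordan_mem_jordanBlocks (k + 1) γ) (h.swap.unshift γ)⟩
  · obtain ⟨π, hπ, h⟩ := exists_retraction_of_injective (blockC (.jordan k γ))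
      (blockA (.jordan k γ) + (-α) • blockC (.jordan k γ)) (blockA_sub_injective k h)
    exact ⟨π, hπ, isSumOfBlocks_single (jordan_mem_jordanBlocks k γ) (h.swap.unshift α)⟩

end SumOfBlocks

/-! ### Jordan normal form and the inductive step -/

universe u v

theorem prodMap_add_smul {K : Type*} [Field K] {V W V' W' : Type*}
    [AddCommGroup V] [Module K V] [AddCommGroup W] [Module K W]
    [AddCommGroup V'] [Module K V'] [AddCommGroup W'] [Module K W']
    (a c : V →ₗ[K] W) (a' c' : V' →ₗ[K] W') (α : K) :
    a.prodMap a' + α • c.prodMap c' = (a + α • c).prodMap (a' + α • c') := rfl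

/-- Jordan normal form, for the pencil `a - λ c` with an invertible map `c`. -/
theorem isSumOfBlocks_of_bijective (n : ℕ) :
    ∀ (V : Type u) (W : Type v) [AddCommGroup V] [Module ℂ V] [AddCommGroup W] [Module ℂ W]
      [FiniteDimensional ℂ V] (a c : V →ₗ[ℂ] W), Function.Bijective c →
      Module.finrank ℂ V = n → IsSumOfBlocks jordanBlocks a c := by
  induction n using Nat.strong_induction_on with
  | _ n ih =>
  intro V W _ _ _ _ _ a c hc hn
  rcases subsingleton_or_nontrivial V with hV | hV
  · have : Subsingleton W := hc.2.subsingleton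
    exact isSumOfBlocks_of_subsingleton _ _ _
  -- an eigenvalue `α` of `c⁻¹ a` makes `f = a - α c` singular, and `(c, f)` can be bordered
  let e := LinearEquiv.ofBijective c hc
  obtain ⟨α, hα⟩ := Module.End.exists_eigenvalue (e.symm.toLinearMap ∘ₗ a)
  obtain ⟨v, hv⟩ := hα.exists_hasEigenvector
  set f := a + (-α) • c with hf
  have hfv : f v = 0 := by
    have h1 : e.symm (a v) = α • v := hv.apply_eq_smul
    rw [LinearEquiv.symm_apply_eq, map_smul] at h1
    change a v + (-α) • c v = 0
    rw [h1]
    change α • c v + (-α) • c v = 0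
    module
  obtain ⟨V₁, W₁, g₂, f₂, f₁, h, hinj, hbij⟩ := exists_bordered c f
    (fun v _ hv => hc.1 (hv.trans (map_zero c).symm))
  have hlt : Module.finrank ℂ V₁ < n := by
    obtain ⟨φ, -⟩ := h
    have h1 := φ.finrank_eq
    rw [Module.finrank_prod] at h1
    have : 0 < Module.finrank ℂ (LinearMap.ker f) :=
      Module.finrank_pos_iff_exists_ne_zero.2 ⟨⟨v, hfv⟩, fun h => hv.2 (congrArg Subtype.val h)⟩
    omega
  obtain ⟨ι, _, b, hb, hiso⟩ := ih _ hlt V₁ W₁ (f₂ + α • g₂) g₂ (hbij hc) rfl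
  choose π hπ hsum using fun i => exists_retraction_jordan (hb i) α
  have hiso' : PencilIso g₂ f₂ (LinearMap.piMap fun i => blockC (b i))
      (LinearMap.piMap fun i => blockA (b i) + (-α) • blockC (b i)) := by
    have := hiso.shift (-α)
    rw [add_assoc, ← add_smul, add_neg_cancel, zero_smul, add_zero] at this
    exact this.swap
  obtain ⟨U₀, h'⟩ := bordered_iso_pi _ _ hiso' f₁ hinj π hπ
  have htot := (h.trans h').swap.shift α
  have hfa : f + α • c = a := by rw [hf]; module
  rw [hfa, prodMap_add_smul, zero_add] at htot
  exact ((isSumOfBlocks_smul_id_id α).prod (IsSumOfBlocks.pi hsum)).of_iso htot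

/-- The inductive step for a pencil `a - λ c` with a singular map `c`. -/
theorem isSumOfBlocks_of_ker_ne_bot (n : ℕ)
    (ih : ∀ (V : Type u) (W : Type v) [AddCommGroup V] [Module ℂ V] [AddCommGroup W] [Module ℂ W]
      [FiniteDimensional ℂ V] [FiniteDimensional ℂ W] (a c : V →ₗ[ℂ] W),
      Module.finrank ℂ V + Module.finrank ℂ W < n → IsSumOfBlocks Set.univ a c)
    (V : Type u) (W : Type v) [AddCommGroup V] [Module ℂ V] [AddCommGroup W] [Module ℂ W]
    [FiniteDimensional ℂ V] [FiniteDimensional ℂ W] (a c : V →ₗ[ℂ] W)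
    (hc : ¬ Function.Injective c) (hn : Module.finrank ℂ V + Module.finrank ℂ W = n) :
    IsSumOfBlocks Set.univ a c := by
  by_cases hinj : ∀ v, c v = 0 → a v = 0 → v = 0
  · obtain ⟨V₁, W₁, g₂, f₂, f₁, h, hinj', -⟩ := exists_bordered a c hinj
    have hlt : Module.finrank ℂ V₁ + Module.finrank ℂ W₁ < n := by
      obtain ⟨φ, -⟩ := h
      have h1 := φ.finrank_eq
      rw [Module.finrank_prod] at h1
      have : 0 < Module.finrank ℂ (LinearMap.ker c) := by
        rw [Nat.pos_iff_ne_zero, Ne, Submodule.finrank_eq_zero, LinearMap.ker_eq_bot]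
        exact hc
      have := Submodule.finrank_le W₁
      omega
    obtain ⟨ι, _, b, -, hiso⟩ := ih V₁ W₁ g₂ f₂ hlt
    choose π hπ hsum using fun i => exists_retraction_block (b i)
    obtain ⟨U₀, h'⟩ := bordered_iso_pi _ _ hiso f₁ hinj' π hπ
    exact (isSumOfBlocks_id_zero.prod (IsSumOfBlocks.pi hsum)).of_iso (h.trans h')
  · push Not at hinj
    obtain ⟨v, hcv, hav, hv⟩ := hinj
    -- the common kernel splits off as a sum of blocks `L₀`
    set N := LinearMap.ker a ⊓ LinearMap.ker c with hN
    obtain ⟨V₁, hV⟩ := Submodule.exists_isCompl N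
    have hlt : Module.finrank ℂ V₁ + Module.finrank ℂ W < n := by
      have h1 := Submodule.finrank_add_eq_of_isCompl hV
      have : 0 < Module.finrank ℂ N :=
        Module.finrank_pos_iff_exists_ne_zero.2
          ⟨⟨v, hav, hcv⟩, fun h => hv (congrArg Subtype.val h)⟩
      omega
    refine ((isSumOfBlocks_of_subsingleton_right (0 : N →ₗ[ℂ] PUnit.{1}) 0).prod
      (ih V₁ W (a ∘ₗ V₁.subtype) (c ∘ₗ V₁.subtype) hlt)).of_iso (PencilIso.symm
      ⟨Submodule.prodEquivOfIsCompl _ _ hV, LinearEquiv.uniqueProd, ?_, ?_⟩)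
    · rintro ⟨⟨x, hx⟩, y⟩
      have : a x = 0 := hx.1
      simp [this]
    · rintro ⟨⟨x, hx⟩, y⟩
      have : c x = 0 := hx.2
      simp [this]

/-! ### Strict equivalence, transposition and Kronecker's theorem -/

open Matrix

section StrictEquiv

variable {ι κ ι' κ' : Type} [Fintype ι] [DecidableEq ι] [Fintype κ] [DecidableEq κ]

theorem StrictEquiv.transpose {A C : Matrix ι κ ℂ} {A' C' : Matrix ι' κ' ℂ}
    (h : StrictEquiv A C A' C') : StrictEquiv Aᵀ Cᵀ A'ᵀ C'ᵀ := by
  obtain ⟨e, f, P, Q, hP, hQ, hA, hC⟩ := h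
  refine ⟨f, e, Qᵀ, Pᵀ, (isUnit_transpose Q).2 hQ, (isUnit_transpose P).2 hP, ?_, ?_⟩
  · rw [← transpose_submatrix, ← hA, transpose_mul, transpose_mul, Matrix.mul_assoc]
  · rw [← transpose_submatrix, ← hC, transpose_mul, transpose_mul, Matrix.mul_assoc]

variable [Fintype ι'] [Fintype κ']

theorem strictEquiv_iff_pencilIso {A C : Matrix ι κ ℂ} {A' C' : Matrix ι' κ' ℂ} :
    StrictEquiv A C A' C' ↔
      PencilIso A.mulVecLin C.mulVecLin A'.mulVecLin C'.mulVecLin := by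
  constructor
  · rintro ⟨e, f, P, Q, hP, hQ, hA, hC⟩
    let P' := LinearEquiv.ofBijective P.mulVecLin
      ⟨mulVec_injective_iff_isUnit.2 hP, mulVec_surjective_iff_isUnit.2 hP⟩
    let Q' := LinearEquiv.ofBijective Q.mulVecLin
      ⟨mulVec_injective_iff_isUnit.2 hQ, mulVec_surjective_iff_isUnit.2 hQ⟩
    have key : ∀ (M : Matrix ι κ ℂ) (M' : Matrix ι' κ' ℂ), P * M * Q = M'.submatrix e f → ∀ v,
        (P'.trans (LinearEquiv.funCongrLeft ℂ ℂ e.symm)) (M.mulVecLin v) =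
        M'.mulVecLin ((Q'.symm.trans (LinearEquiv.funCongrLeft ℂ ℂ f.symm)) v) := by
      intro M M' h v
      obtain ⟨u, rfl⟩ := Q'.surjective v
      have h1 : P.mulVec (M.mulVec (Q.mulVec u)) = M'.mulVec (u ∘ f.symm) ∘ e := by
        rw [← submatrix_mulVec_equiv, ← h, mulVec_mulVec, mulVec_mulVec, Matrix.mul_assoc]
      change (P.mulVec (M.mulVec (Q.mulVec u))) ∘ e.symm =
        M'.mulVec ((Q'.symm (Q' u)) ∘ f.symm)
      rw [h1, LinearEquiv.symm_apply_apply]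
      ext i
      simp
    exact ⟨_, _, key A A' hA, key C C' hC⟩
  · rintro ⟨φ, ψ, hA, hC⟩
    have hι : Fintype.card ι = Fintype.card ι' := by simpa using ψ.finrank_eq
    have hκ : Fintype.card κ = Fintype.card κ' := by simpa using φ.finrank_eq
    let e := Fintype.equivOfCardEq hι
    let f := Fintype.equivOfCardEq hκ
    let P := ψ.trans (LinearEquiv.funCongrLeft ℂ ℂ e)
    let Q := (LinearEquiv.funCongrLeft ℂ ℂ f.symm).trans φ.symm
    have key : ∀ (M : Matrix ι κ ℂ) (M' : Matrix ι' κ' ℂ),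
        (∀ v, ψ (M.mulVecLin v) = M'.mulVecLin (φ v)) →
        LinearMap.toMatrix' P.toLinearMap * M * LinearMap.toMatrix' Q.toLinearMap =
          M'.submatrix e f := by
      intro M M' h
      refine mulVec_injective (funext fun u => ?_)
      rw [← mulVec_mulVec, ← mulVec_mulVec, submatrix_mulVec_equiv,
        LinearMap.toMatrix'_mulVec, LinearMap.toMatrix'_mulVec]
      change (ψ (M.mulVecLin (φ.symm (u ∘ f.symm)))) ∘ e = _
      rw [h, LinearEquiv.apply_symm_apply]
      rfl
    refine ⟨e, f, _, _, ?_, ?_, key A A' hA, key C C' hC⟩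
    · rw [← mulVec_injective_iff_isUnit]
      intro x y h
      simpa [LinearMap.toMatrix'_mulVec] using h
    · rw [← mulVec_injective_iff_isUnit]
      intro x y h
      simpa [LinearMap.toMatrix'_mulVec] using h

end StrictEquiv

section BlockDiagonal

variable {ο : Type} [Fintype ο] [DecidableEq ο] {r s : ο → Type}
  [∀ i, Fintype (s i)]

theorem blockDiagonal'_mulVec_apply (M : ∀ i, Matrix (r i) (s i) ℂ) (v : (Σ i, s i) → ℂ)
    (i : ο) (x : r i) :
    (blockDiagonal' M).mulVec v ⟨i, x⟩ = (M i).mulVec (fun y => v ⟨i, y⟩) x := by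
  simp only [mulVec, dotProduct, Fintype.sum_sigma]
  rw [Finset.sum_eq_single i]
  · simp
  · intro j _ hj
    exact Finset.sum_eq_zero fun y _ => by rw [blockDiagonal'_apply_ne _ _ _ hj.symm, zero_mul]
  · simp

theorem pencilIso_blockDiagonal' (M N : ∀ i, Matrix (r i) (s i) ℂ) :
    PencilIso (blockDiagonal' M).mulVecLin (blockDiagonal' N).mulVecLin
      (LinearMap.piMap fun i => (M i).mulVecLin) (LinearMap.piMap fun i => (N i).mulVecLin) :=
  ⟨LinearEquiv.piCurry ℂ (fun i (_ : s i) => ℂ), LinearEquiv.piCurry ℂ (fun i (_ : r i) => ℂ),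
    fun v => funext fun i => funext fun x => blockDiagonal'_mulVec_apply M v i x,
    fun v => funext fun i => funext fun x => blockDiagonal'_mulVec_apply N v i x⟩

end BlockDiagonal

/-- The block whose pencil is strictly equivalent to the transposed pencil. -/
def KroneckerBlock.transpose : KroneckerBlock → KroneckerBlock
  | right ε => left ε
  | left η => right η
  | jordan k α => jordan k α
  | jordanInf k => jordanInf k

@[simp]
theorem KroneckerBlock.transpose_transpose (β : KroneckerBlock) : β.transpose.transpose = β := by
  cases β <;> rfl

theorem superOnes_rev (k : ℕ) :
    (superOnes k k).submatrix Fin.revPerm Fin.revPerm = (superOnes k k)ᵀ := by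
  ext i j
  simp only [superOnes, submatrix_apply, of_apply, transpose_apply, Fin.revPerm_apply, Fin.val_rev]
  congr 1
  have := i.2
  have := j.2
  apply propext
  omega

/-- Reversing the order of the basis transposes a Jordan block. -/
theorem pencilIso_transpose_of_rev {k : ℕ} (M N : Matrix (Fin k) (Fin k) ℂ)
    (hM : M.submatrix Fin.revPerm Fin.revPerm = Mᵀ)
    (hN : N.submatrix Fin.revPerm Fin.revPerm = Nᵀ) :
    PencilIso Mᵀ.mulVecLin Nᵀ.mulVecLin M.mulVecLin N.mulVecLin := by
  have key : ∀ L : Matrix (Fin k) (Fin k) ℂ, L.submatrix Fin.revPerm Fin.revPerm = Lᵀ → ∀ v,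
      LinearEquiv.funCongrLeft ℂ ℂ Fin.revPerm (Lᵀ.mulVecLin v) =
        L.mulVecLin (LinearEquiv.funCongrLeft ℂ ℂ Fin.revPerm v) := by
    intro L hL v
    rw [← hL]
    change ((L.submatrix Fin.revPerm Fin.revPerm).mulVec v) ∘ Fin.revPerm =
      L.mulVec (v ∘ Fin.revPerm)
    rw [submatrix_mulVec_equiv]
    ext i
    simp [Fin.revPerm_symm]
  exact ⟨_, _, key M hM, key N hN⟩

theorem pencilIso_block_transpose (β : KroneckerBlock) :
    PencilIso β.coeffAᵀ.mulVecLin β.coeffCᵀ.mulVecLin (blockA β.transpose)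
      (blockC β.transpose) := by
  have hd : ∀ k, (diagOnes k k).submatrix Fin.revPerm Fin.revPerm = (diagOnes k k)ᵀ := by
    intro k
    rw [diagOnes_self, submatrix_one_equiv, transpose_one]
  cases β with
  | right ε => exact PencilIso.refl _ _
  | left η => exact PencilIso.refl _ _
  | jordan k α =>
    refine pencilIso_transpose_of_rev (α • diagOnes (k + 1) (k + 1) + superOnes (k + 1) (k + 1))
      (diagOnes (k + 1) (k + 1)) ?_ (hd _)
    rw [submatrix_add, submatrix_smul]
    simp [hd, superOnes_rev]
  | jordanInf k => exact pencilIso_transpose_of_rev _ _ (hd (k + 1)) (superOnes_rev _)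

section KCF

variable {ι κ : Type} [Fintype ι] [DecidableEq ι] [Fintype κ] [DecidableEq κ]
  {A C : Matrix ι κ ℂ}

theorem isKCF_iff_pencilIso {k : ℕ} {b : Fin k → KroneckerBlock} :
    IsKCF A C b ↔ PencilIso A.mulVecLin C.mulVecLin (LinearMap.piMap fun i => blockA (b i))
      (LinearMap.piMap fun i => blockC (b i)) :=
  strictEquiv_iff_pencilIso.trans ⟨fun h => h.trans (pencilIso_blockDiagonal' _ _),
    fun h => h.trans (pencilIso_blockDiagonal' _ _).symm⟩

theorem IsSumOfBlocks.kcfIsSumOf {S : Set KroneckerBlock}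
    (h : IsSumOfBlocks S A.mulVecLin C.mulVecLin) : KCFIsSumOf A C S := by
  obtain ⟨o, _, b, hb, hi⟩ := h
  let e := Fintype.equivFin o
  refine ⟨Fintype.card o, b ∘ e.symm, isKCF_iff_pencilIso.2 (hi.trans
    ⟨LinearEquiv.piCongrLeft' ℂ (fun i => Fin (b i).cols → ℂ) e,
      LinearEquiv.piCongrLeft' ℂ (fun i => Fin (b i).rows → ℂ) e, fun v => rfl, fun v => rfl⟩),
    fun i => hb _⟩

theorem IsKCF.transpose {k : ℕ} {b : Fin k → KroneckerBlock} (h : IsKCF A C b) :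
    IsKCF Aᵀ Cᵀ (fun i => (b i).transpose) := by
  have h1 := strictEquiv_iff_pencilIso.1 (StrictEquiv.transpose h)
  rw [blockDiagonal'_transpose, blockDiagonal'_transpose] at h1
  exact isKCF_iff_pencilIso.2 ((h1.trans (pencilIso_blockDiagonal' _ _)).trans
    (PencilIso.pi fun i => pencilIso_block_transpose (b i)))

theorem kcfContains_transpose_iff {β : KroneckerBlock} :
    KCFContains Aᵀ Cᵀ β ↔ KCFContains A C β.transpose := by
  constructor
  · rintro ⟨k, b, h, i, rfl⟩
    exact ⟨k, _, h.transpose, i, rfl⟩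
  · rintro ⟨k, b, h, i, hi⟩
    exact ⟨k, _, h.transpose, i, by rw [hi, KroneckerBlock.transpose_transpose]⟩

theorem kcfIsSumOf_transpose_iff {S : Set KroneckerBlock} :
    KCFIsSumOf Aᵀ Cᵀ S ↔ KCFIsSumOf A C {β | β.transpose ∈ S} := by
  constructor
  · rintro ⟨k, b, h, hb⟩
    exact ⟨k, _, h.transpose, fun i => by simpa using hb i⟩
  · rintro ⟨k, b, h, hb⟩
    exact ⟨k, _, h.transpose, hb⟩

end KCF

/-- Kronecker's theorem: every pencil of finite-dimensional spaces is a direct sum of blocks. -/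
theorem isSumOfBlocks_univ (n : ℕ) :
    ∀ (V W : Type) [AddCommGroup V] [Module ℂ V] [AddCommGroup W] [Module ℂ W]
      [FiniteDimensional ℂ V] [FiniteDimensional ℂ W] (a c : V →ₗ[ℂ] W),
      Module.finrank ℂ V + Module.finrank ℂ W < n → IsSumOfBlocks Set.univ a c := by
  induction n with
  | zero => intro V W _ _ _ _ _ _ a c h; omega
  | succ n ih =>
  intro V W _ _ _ _ _ _ a c hn
  rcases Nat.lt_succ_iff_lt_or_eq.1 hn with hn | hn
  · exact ih V W a c hn
  by_cases hinj : Function.Injective c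
  swap
  · exact isSumOfBlocks_of_ker_ne_bot n ih V W a c hinj hn
  by_cases hsurj : Function.Surjective c
  · obtain ⟨o, ho, b, -, h⟩ := isSumOfBlocks_of_bijective _ V W a c ⟨hinj, hsurj⟩ rfl
    exact ⟨o, ho, b, fun i => Set.mem_univ _, h⟩
  -- if `c` is not surjective, the transpose of `c` is not injective
  let e := (Module.finBasis ℂ V).equivFun
  let f := (Module.finBasis ℂ W).equivFun
  let M : (V →ₗ[ℂ] W) → Matrix (Fin (Module.finrank ℂ W)) (Fin (Module.finrank ℂ V)) ℂ :=
    fun g => LinearMap.toMatrix' (f.toLinearMap ∘ₗ g ∘ₗ e.symm.toLinearMap)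
  have hM : ∀ g v, f (g v) = (M g).mulVecLin (e v) := fun g v => by
    simp [M, LinearMap.toMatrix'_mulVec]
  have hac : PencilIso a c (M a).mulVecLin (M c).mulVecLin := ⟨e, f, hM a, hM c⟩
  have hT : ¬ Function.Injective (M c)ᵀ.mulVecLin := by
    intro h
    apply hsurj
    have h1 : (M c)ᵀ.rank = Module.finrank ℂ W := by
      simpa [Matrix.rank] using LinearMap.finrank_range_of_inj h
    rw [rank_transpose] at h1
    have h2 : LinearMap.range (M c).mulVecLin = ⊤ :=
      Submodule.eq_top_of_finrank_eq (h1.trans (by simp))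
    intro w
    obtain ⟨u, hu⟩ := LinearMap.range_eq_top.1 h2 (f w)
    refine ⟨e.symm u, f.injective ?_⟩
    rw [hM, LinearEquiv.apply_symm_apply, hu]
  obtain ⟨k, b, h, -⟩ := (isSumOfBlocks_of_ker_ne_bot n ih _ _ (M a)ᵀ.mulVecLin
    (M c)ᵀ.mulVecLin hT (by simpa [add_comm] using hn)).kcfIsSumOf
  exact ⟨Fin k, inferInstance, _, fun i => Set.mem_univ _,
    hac.trans (isKCF_iff_pencilIso.1 h.transpose)⟩

/-- Every matrix pencil has a Kronecker canonical form. -/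
theorem exists_isKCF {ι κ : Type} [Fintype ι] [DecidableEq ι] [Fintype κ] [DecidableEq κ]
    (A C : Matrix ι κ ℂ) : ∃ (k : ℕ) (b : Fin k → KroneckerBlock), IsKCF A C b := by
  obtain ⟨k, b, h, -⟩ := (isSumOfBlocks_univ _ _ _ A.mulVecLin C.mulVecLin
    (Nat.lt_succ_self _)).kcfIsSumOf
  exact ⟨k, b, h⟩

/-! ### Solvability for every right-hand side -/

open Kronecker

section Solvable

variable {ι κ ι' κ' : Type} [Fintype κ] [Fintype κ']

/-- The equation `A X C'ᵀ - C X A'ᵀ = E` has a solution `X` for every right-hand side `E`. In this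
form the generalized Sylvester equation is symmetric in the pencils `A - λ C` and `A' - λ C'`. -/
def AlwaysSolvable (A C : Matrix ι κ ℂ) (A' C' : Matrix ι' κ' ℂ) : Prop :=
  ∀ E : Matrix ι ι' ℂ, ∃ X : Matrix κ κ' ℂ, A * X * C'ᵀ - C * X * A'ᵀ = E

theorem AlwaysSolvable.swap {A C : Matrix ι κ ℂ} {A' C' : Matrix ι' κ' ℂ}
    (h : AlwaysSolvable A C A' C') : AlwaysSolvable A' C' A C := by
  intro E
  obtain ⟨X, hX⟩ := h (-Eᵀ)
  refine ⟨Xᵀ, ?_⟩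
  have := congrArg Matrix.transpose hX
  simp only [transpose_sub, transpose_mul, Matrix.transpose_transpose, transpose_neg] at this
  rw [← neg_sub, ← Matrix.mul_assoc, ← Matrix.mul_assoc] at this
  exact neg_injective this

/-- Solvability for every right-hand side is surjectivity of a Kronecker product matrix. -/
theorem alwaysSolvable_iff_kronecker {A C : Matrix ι κ ℂ} {A' C' : Matrix ι' κ' ℂ} :
    AlwaysSolvable A C A' C' ↔ Function.Surjective (C' ⊗ₖ A - A' ⊗ₖ C).mulVec := by
  have key : ∀ X : Matrix κ κ' ℂ,
      (C' ⊗ₖ A - A' ⊗ₖ C).mulVec (vec X) = vec (A * X * C'ᵀ - C * X * A'ᵀ) := fun X => by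
    rw [sub_mulVec, kronecker_mulVec_vec, kronecker_mulVec_vec, vec_sub]
  constructor
  · intro h e
    obtain ⟨E, rfl⟩ := vec_bijective.2 e
    obtain ⟨X, rfl⟩ := h E
    exact ⟨vec X, key X⟩
  · intro h E
    obtain ⟨x, hx⟩ := h (vec E)
    obtain ⟨X, rfl⟩ := vec_bijective.2 x
    exact ⟨X, vec_inj.1 ((key X).symm.trans hx)⟩

theorem injective_iff_kronecker {A C : Matrix ι κ ℂ} {A' C' : Matrix ι' κ' ℂ} :
    (Function.Injective fun X : Matrix κ κ' ℂ => A * X * C'ᵀ - C * X * A'ᵀ) ↔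
      Function.Injective (C' ⊗ₖ A - A' ⊗ₖ C).mulVec := by
  have key : ∀ X : Matrix κ κ' ℂ,
      (C' ⊗ₖ A - A' ⊗ₖ C).mulVec (vec X) = vec (A * X * C'ᵀ - C * X * A'ᵀ) := fun X => by
    rw [sub_mulVec, kronecker_mulVec_vec, kronecker_mulVec_vec, vec_sub]
  constructor
  · intro h x y hxy
    obtain ⟨X, rfl⟩ := vec_bijective.2 x
    obtain ⟨Y, rfl⟩ := vec_bijective.2 y
    rw [key, key] at hxy
    rw [h (vec_inj.1 hxy)]
  · intro h X Y hXY
    exact vec_inj.1 (h (by rw [key, key]; exact congrArg vec hXY))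

end Solvable

section Rank

theorem mulVec_injective_iff_rank {ι κ : Type} [Fintype κ] {M : Matrix ι κ ℂ} :
    Function.Injective M.mulVec ↔ M.rank = Fintype.card κ := by
  change Function.Injective M.mulVecLin ↔ _
  rw [← LinearMap.ker_eq_bot, ← Submodule.finrank_eq_zero]
  have := M.mulVecLin.finrank_range_add_finrank_ker
  rw [Module.finrank_fintype_fun_eq_card] at this
  rw [Matrix.rank]
  omega

variable {ι κ : Type} [Fintype ι] [Fintype κ]

theorem mulVec_surjective_iff_rank {M : Matrix ι κ ℂ} :
    Function.Surjective M.mulVec ↔ M.rank = Fintype.card ι := by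
  change Function.Surjective M.mulVecLin ↔ _
  rw [← LinearMap.range_eq_top]
  constructor
  · intro h
    rw [Matrix.rank, h, finrank_top, Module.finrank_fintype_fun_eq_card]
  · intro h
    exact Submodule.eq_top_of_finrank_eq (by
      rw [Module.finrank_fintype_fun_eq_card]
      exact h)

theorem mulVec_injective_iff_transpose_surjective {M : Matrix ι κ ℂ} :
    Function.Injective M.mulVec ↔ Function.Surjective Mᵀ.mulVec := by
  rw [mulVec_injective_iff_rank, mulVec_surjective_iff_rank, rank_transpose]

theorem card_le_of_mulVec_surjective {M : Matrix ι κ ℂ} (h : Function.Surjective M.mulVec) :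
    Fintype.card ι ≤ Fintype.card κ := by
  rw [← mulVec_surjective_iff_rank.1 h]
  exact M.rank_le_card_width

theorem exists_vecMul_eq_zero {M : Matrix ι κ ℂ} (h : ¬ Function.Surjective M.mulVec) :
    ∃ x, x ≠ 0 ∧ x ᵥ* M = 0 := by
  have h1 : ¬ Function.Injective Mᵀ.mulVecLin := fun h' =>
    h (by simpa using mulVec_injective_iff_transpose_surjective.1 h')
  rw [← LinearMap.ker_eq_bot, Submodule.eq_bot_iff] at h1
  push Not at h1
  obtain ⟨x, hx, hx0⟩ := h1
  exact ⟨x, hx0, by simpa [mulVec_transpose] using hx⟩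

/-- An eigenvalue lowers the rank, so that the pencil is not surjective there. -/
theorem IsEigenvalue.not_surjective {A C : Matrix ι κ ℂ} {α : OnePoint ℂ}
    (h : IsEigenvalue A C α) : ¬ Function.Surjective (evalAt A C α).mulVec := by
  obtain ⟨μ, hμ⟩ := h
  rw [mulVec_surjective_iff_rank]
  have := (A - μ • C).rank_le_card_height
  omega

theorem isEigenvalue_of_not_surjective {A C : Matrix ι κ ℂ} {α : OnePoint ℂ} {μ : ℂ}
    (hμ : Function.Surjective (A - μ • C).mulVec)
    (h : ¬ Function.Surjective (evalAt A C α).mulVec) : IsEigenvalue A C α := by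
  rw [mulVec_surjective_iff_rank] at hμ h
  have := (evalAt A C α).rank_le_card_height
  exact ⟨μ, by omega⟩

theorem isEigenvalue_transpose_iff {A C : Matrix ι κ ℂ} {α : OnePoint ℂ} :
    IsEigenvalue Aᵀ Cᵀ α ↔ IsEigenvalue A C α := by
  have h1 : ∀ μ : ℂ, (Aᵀ - μ • Cᵀ).rank = (A - μ • C).rank := fun μ => by
    rw [← rank_transpose (A - μ • C), transpose_sub, transpose_smul]
  have h2 : (evalAt Aᵀ Cᵀ α).rank = (evalAt A C α).rank := by
    cases α using OnePoint.rec with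
    | infty => exact rank_transpose C
    | coe z => exact h1 z
  simp only [IsEigenvalue, h1, h2]

end Rank

section SolvableFintype

variable {ι κ ι' κ' : Type} [Fintype ι] [Fintype κ] [Fintype ι'] [Fintype κ']

/-- The adjoint of the operator of a pair of pencils is the operator of the transposed pencils. -/
theorem injective_iff_alwaysSolvable_transpose {A C : Matrix ι κ ℂ} {A' C' : Matrix ι' κ' ℂ} :
    (Function.Injective fun X : Matrix κ κ' ℂ => A * X * C'ᵀ - C * X * A'ᵀ) ↔
      AlwaysSolvable Aᵀ Cᵀ A'ᵀ C'ᵀ := by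
  rw [injective_iff_kronecker, alwaysSolvable_iff_kronecker,
    mulVec_injective_iff_transpose_surjective, transpose_sub, kroneckerMap_transpose,
    kroneckerMap_transpose]

theorem AlwaysSolvable.card_le {A C : Matrix ι κ ℂ} {A' C' : Matrix ι' κ' ℂ}
    (h : AlwaysSolvable A C A' C') :
    Fintype.card ι' * Fintype.card ι ≤ Fintype.card κ' * Fintype.card κ := by
  simpa using card_le_of_mulVec_surjective (alwaysSolvable_iff_kronecker.1 h)

/-- If both pencils fail to be surjective at the same point, then left null vectors `x` and `y` give
a functional `E ↦ xᵀ E y` that vanishes on the range. -/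
theorem AlwaysSolvable.surjective_or [DecidableEq ι] [DecidableEq ι'] {A C : Matrix ι κ ℂ}
    {A' C' : Matrix ι' κ' ℂ} (h : AlwaysSolvable A C A' C') (α : OnePoint ℂ) :
    Function.Surjective (evalAt A C α).mulVec ∨ Function.Surjective (evalAt A' C' α).mulVec := by
  by_contra hcon
  push Not at hcon
  obtain ⟨x, hx0, hx⟩ := exists_vecMul_eq_zero hcon.1
  obtain ⟨y, hy0, hy⟩ := exists_vecMul_eq_zero hcon.2
  have key : ∀ X : Matrix κ κ' ℂ, x ⬝ᵥ (A * X * C'ᵀ - C * X * A'ᵀ) *ᵥ y = 0 := by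
    intro X
    have h1 : x ⬝ᵥ (A * X * C'ᵀ - C * X * A'ᵀ) *ᵥ y =
        (x ᵥ* A) ⬝ᵥ X *ᵥ (y ᵥ* C') - (x ᵥ* C) ⬝ᵥ X *ᵥ (y ᵥ* A') := by
      rw [sub_mulVec, dotProduct_sub]
      simp only [← mulVec_mulVec, mulVec_transpose, dotProduct_mulVec]
    rw [h1]
    cases α using OnePoint.rec with
    | infty =>
      have hx' : x ᵥ* C = 0 := hx
      have hy' : y ᵥ* C' = 0 := hy
      simp [hx', hy']
    | coe z =>
      have hx' : x ᵥ* A = z • (x ᵥ* C) := by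
        have : x ᵥ* (A - z • C) = 0 := hx
        rwa [vecMul_sub, vecMul_smul, sub_eq_zero] at this
      have hy' : y ᵥ* A' = z • (y ᵥ* C') := by
        have : y ᵥ* (A' - z • C') = 0 := hy
        rwa [vecMul_sub, vecMul_smul, sub_eq_zero] at this
      rw [hx', hy', smul_dotProduct, mulVec_smul, dotProduct_smul, sub_self]
  obtain ⟨i, hi⟩ := Function.ne_iff.1 hx0
  obtain ⟨j, hj⟩ := Function.ne_iff.1 hy0
  obtain ⟨X, hX⟩ := h (single i j 1)
  have := key X
  rw [hX] at this
  rw [single_mulVec, one_mul] at this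
  have h2 : x ⬝ᵥ Pi.single i (y j) = 0 := this
  rw [dotProduct_single] at h2
  exact mul_ne_zero hi hj h2

theorem AlwaysSolvable.noCommonEigenvalue [DecidableEq ι] [DecidableEq ι'] {A C : Matrix ι κ ℂ}
    {A' C' : Matrix ι' κ' ℂ} (h : AlwaysSolvable A C A' C') :
    NoCommonEigenvalue A C A' C' := fun α hα =>
  (h.surjective_or α).elim hα.1.not_surjective hα.2.not_surjective

end SolvableFintype

section Invariance

variable {ι κ ι₁ κ₁ ι' κ' : Type} [Fintype ι] [DecidableEq ι] [Fintype κ] [DecidableEq κ]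
  [Fintype κ₁] [Fintype κ']

theorem AlwaysSolvable.of_strictEquiv {A C : Matrix ι κ ℂ} {A₁ C₁ : Matrix ι₁ κ₁ ℂ}
    {A' C' : Matrix ι' κ' ℂ} (hs : StrictEquiv A C A₁ C₁) (h : AlwaysSolvable A C A' C') :
    AlwaysSolvable A₁ C₁ A' C' := by
  obtain ⟨e, f, P, Q, hP, hQ, hA, hC⟩ := hs
  intro E
  obtain ⟨X, hX⟩ := h (P⁻¹ * E.submatrix e id)
  refine ⟨(Q⁻¹ * X).submatrix f.symm id, ?_⟩
  have key : ∀ (M : Matrix ι κ ℂ) (M₁ : Matrix ι₁ κ₁ ℂ) (N : Matrix ι' κ' ℂ),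
      P * M * Q = M₁.submatrix e f →
      M₁ * (Q⁻¹ * X).submatrix f.symm id * Nᵀ = (P * (M * X * Nᵀ)).submatrix e.symm id := by
    intro M M₁ N hM
    have h1 : M₁ = (P * M * Q).submatrix e.symm f.symm := by rw [hM]; simp
    rw [h1, submatrix_mul_equiv]
    have h2 : P * M * Q * (Q⁻¹ * X) = P * (M * X) := by
      rw [Matrix.mul_assoc (P * M), ← Matrix.mul_assoc Q,
        mul_nonsing_inv _ ((isUnit_iff_isUnit_det Q).1 hQ), Matrix.one_mul, Matrix.mul_assoc]
    rw [h2, ← Matrix.mul_assoc P (M * X)]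
    rfl
  rw [key A A₁ C' hA, key C C₁ A' hC]
  change (P * (A * X * C'ᵀ) - P * (C * X * A'ᵀ)).submatrix e.symm id = E
  rw [← Matrix.mul_sub, hX, ← Matrix.mul_assoc,
    mul_nonsing_inv _ ((isUnit_iff_isUnit_det P).1 hP), Matrix.one_mul]
  simp

variable [Fintype ι₁] [DecidableEq ι₁] [DecidableEq κ₁]

theorem StrictEquiv.symm {A C : Matrix ι κ ℂ} {A₁ C₁ : Matrix ι₁ κ₁ ℂ}
    (h : StrictEquiv A C A₁ C₁) : StrictEquiv A₁ C₁ A C :=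
  strictEquiv_iff_pencilIso.2 (strictEquiv_iff_pencilIso.1 h).symm

theorem alwaysSolvable_blockDiagonal'_iff {o : Type} [Fintype o] [DecidableEq o] {r s : o → Type}
    [∀ i, Fintype (s i)] (M N : ∀ i, Matrix (r i) (s i) ℂ) {A' C' : Matrix ι' κ' ℂ} :
    AlwaysSolvable (blockDiagonal' M) (blockDiagonal' N) A' C' ↔
      ∀ i, AlwaysSolvable (M i) (N i) A' C' := by
  have key : ∀ (L : ∀ i, Matrix (r i) (s i) ℂ) (K : Matrix ι' κ' ℂ)
      (X : Matrix (Σ i, s i) κ' ℂ) i x y,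
      (blockDiagonal' L * X * Kᵀ) ⟨i, x⟩ y = (L i * X.submatrix (Sigma.mk i) id * Kᵀ) x y := by
    intro L K X i x y
    rw [mul_apply, mul_apply]
    refine Finset.sum_congr rfl fun z _ => ?_
    congr 1
    exact blockDiagonal'_mulVec_apply L (fun j => X j z) i x
  constructor
  · intro h i E
    obtain ⟨X, hX⟩ := h (of fun a y => if ha : a.1 = i then E (ha ▸ a.2) y else 0)
    refine ⟨X.submatrix (Sigma.mk i) id, ?_⟩
    ext x y
    have := congrFun (congrFun hX ⟨i, x⟩) y
    rw [Matrix.sub_apply, key, key] at this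
    simpa using this
  · intro h E
    choose X hX using fun i => h i (E.submatrix (Sigma.mk i) id)
    refine ⟨of fun a y => X a.1 a.2 y, ?_⟩
    ext ⟨i, x⟩ y
    rw [Matrix.sub_apply, key, key]
    exact congrFun (congrFun (hX i) x) y

/-- Solvability can be tested on the pairs of blocks of two Kronecker canonical forms. -/
theorem alwaysSolvable_iff_blocks [Fintype ι'] [DecidableEq ι'] [DecidableEq κ']
    {A C : Matrix ι κ ℂ} {A' C' : Matrix ι' κ' ℂ} {k l : ℕ} {b : Fin k → KroneckerBlock}
    {b' : Fin l → KroneckerBlock} (h : IsKCF A C b) (h' : IsKCF A' C' b') :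
    AlwaysSolvable A C A' C' ↔
      ∀ i j, AlwaysSolvable (b i).coeffA (b i).coeffC (b' j).coeffA (b' j).coeffC := by
  have h1 : AlwaysSolvable A C A' C' ↔
      ∀ i, AlwaysSolvable (b i).coeffA (b i).coeffC A' C' := by
    rw [← alwaysSolvable_blockDiagonal'_iff]
    exact ⟨fun H => H.of_strictEquiv h, fun H => H.of_strictEquiv (StrictEquiv.symm h)⟩
  rw [h1]
  refine forall_congr' fun i => ?_
  rw [show AlwaysSolvable (b i).coeffA (b i).coeffC A' C' ↔
    AlwaysSolvable A' C' (b i).coeffA (b i).coeffC from ⟨.swap, .swap⟩]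
  have h2 : AlwaysSolvable A' C' (b i).coeffA (b i).coeffC ↔
      ∀ j, AlwaysSolvable (b' j).coeffA (b' j).coeffC (b i).coeffA (b i).coeffC := by
    rw [← alwaysSolvable_blockDiagonal'_iff]
    exact ⟨fun H => H.of_strictEquiv h', fun H => H.of_strictEquiv (StrictEquiv.symm h')⟩
  rw [h2]
  exact forall_congr' fun j => ⟨.swap, .swap⟩

/-- Surjectivity at a point can be tested on the blocks of a Kronecker canonical form. -/
theorem surjective_evalAt_iff_blocks {A C : Matrix ι κ ℂ} {k : ℕ} {b : Fin k → KroneckerBlock}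
    (h : IsKCF A C b) (α : OnePoint ℂ) :
    Function.Surjective (evalAt A C α).mulVec ↔
      ∀ i, Function.Surjective (evalAt (b i).coeffA (b i).coeffC α).mulVec := by
  obtain ⟨φ, ψ, h1, h2⟩ := isKCF_iff_pencilIso.1 h
  have key : ∀ v, ψ ((evalAt A C α).mulVec v) =
      Pi.map (fun i => (evalAt (b i).coeffA (b i).coeffC α).mulVec) (φ v) := by
    intro v
    cases α using OnePoint.rec with
    | infty => exact h2 v
    | coe z =>
      change ψ ((A - z • C).mulVec v) = _
      rw [sub_mulVec, smul_mulVec, map_sub, map_smul]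
      refine (congrArg₂ (fun x y => x - z • y) (h1 v) (h2 v)).trans ?_
      ext i
      change _ = ((b i).coeffA - z • (b i).coeffC).mulVec (φ v i) _
      rw [sub_mulVec, smul_mulVec]
      rfl
  constructor
  · intro hs i w
    obtain ⟨v, hv⟩ := hs (ψ.symm (Pi.single i w))
    refine ⟨φ v i, ?_⟩
    have := key v
    rw [hv, LinearEquiv.apply_symm_apply] at this
    simpa using (congrFun this i).symm
  · intro hs w
    obtain ⟨u, hu⟩ := Function.Surjective.piMap hs (ψ w)
    refine ⟨φ.symm u, ψ.injective ?_⟩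
    rw [key, LinearEquiv.apply_symm_apply, hu]

end Invariance

/-! ### Pairs of Kronecker blocks -/

section Rows

variable {ι' κ' : Type}

theorem mul_transpose_row {ι : Type} [Fintype κ'] (M : Matrix ι κ' ℂ) (N : Matrix ι' κ' ℂ) (i : ι) :
    (M * Nᵀ) i = N.mulVec (M i) := by
  ext j
  simp only [mul_apply, transpose_apply, mulVec, dotProduct]
  exact Finset.sum_congr rfl fun _ _ => mul_comm _ _

theorem superOnes_mul_row (k : ℕ) (X : Matrix (Fin (k + 1)) κ' ℂ) (i : Fin k) :
    (superOnes k (k + 1) * X) i = X i.succ :=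
  funext fun j => congrFun (superOnes_mulVec_tail k fun z => X z j) i

theorem diagOnes_mul_row (k : ℕ) (X : Matrix (Fin (k + 1)) κ' ℂ) (i : Fin k) :
    (diagOnes k (k + 1) * X) i = X i.castSucc :=
  funext fun j => congrFun (diagOnes_mulVec_init k fun z => X z j) i

theorem superOnes_mul_row_snoc (k : ℕ) (X : Matrix (Fin (k + 1)) κ' ℂ) (i : Fin (k + 1)) :
    (superOnes (k + 1) (k + 1) * X) i =
      Fin.snoc (α := fun _ => κ' → ℂ) (Fin.tail X) 0 i := by
  ext j
  refine (congrFun (superOnes_mulVec_snoc k fun z => X z j) i).trans ?_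
  refine Fin.lastCases ?_ (fun i => ?_) i <;> simp [Fin.tail]

variable [Fintype κ']

/-- Row by row, the equation for `L_ε` is a recursion for the rows of `X`. -/
theorem alwaysSolvable_right_iff (ε : ℕ) {A' C' : Matrix ι' κ' ℂ} :
    AlwaysSolvable (coeffA (.right ε)) (coeffC (.right ε)) A' C' ↔
      ∀ e : Fin ε → ι' → ℂ, ∃ x : Fin (ε + 1) → κ' → ℂ,
        ∀ i, C'.mulVec (x i.succ) - A'.mulVec (x i.castSucc) = e i := by
  have key : ∀ (X : Matrix (Fin (ε + 1)) κ' ℂ) (i : Fin ε),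
      (superOnes ε (ε + 1) * X * C'ᵀ - diagOnes ε (ε + 1) * X * A'ᵀ) i =
        C'.mulVec (X i.succ) - A'.mulVec (X i.castSucc) := by
    intro X i
    rw [← superOnes_mul_row ε X i, ← diagOnes_mul_row ε X i, ← mul_transpose_row,
      ← mul_transpose_row]
    rfl
  constructor
  · intro h e
    obtain ⟨X, hX⟩ := h (of e)
    exact ⟨X, fun i => (key X i).symm.trans (congrFun hX i)⟩
  · intro h E
    obtain ⟨x, hx⟩ := h E
    exact ⟨of x, funext fun i => (key (of x) i).trans (hx i)⟩

theorem alwaysSolvable_right_of_surjective (ε : ℕ) {A' C' : Matrix ι' κ' ℂ}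
    (hC : Function.Surjective C'.mulVec) :
    AlwaysSolvable (coeffA (.right ε)) (coeffC (.right ε)) A' C' := by
  rw [alwaysSolvable_right_iff]
  intro e
  obtain ⟨g, hg⟩ := hC.hasRightInverse
  let e' : ℕ → ι' → ℂ := fun n => if h : n < ε then e ⟨n, h⟩ else 0
  let x : ℕ → κ' → ℂ := fun n => Nat.rec 0 (fun n y => g (A'.mulVec y + e' n)) n
  refine ⟨fun i => x i, fun i => ?_⟩
  have h1 : C'.mulVec (x (i + 1)) = A'.mulVec (x i) + e' i := hg _
  simp only [Fin.val_succ, Fin.val_castSucc]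
  rw [h1, add_sub_cancel_left]
  simp [e']

/-- For a Jordan chain the recursion for the rows of `X` runs backwards from the last row. -/
theorem exists_backward_recursion {V W : Type*} [AddCommGroup V] [AddCommGroup W] (S T : V → W)
    (hT : T 0 = 0) (hS : Function.Surjective S) (k : ℕ) (e : Fin (k + 1) → W) :
    ∃ x : Fin (k + 1) → V, ∀ i,
      S (x i) + T (Fin.snoc (α := fun _ => V) (Fin.tail x) 0 i) = e i := by
  induction k with
  | zero =>
    obtain ⟨v, hv⟩ := hS (e 0)
    refine ⟨fun _ => v, fun i => ?_⟩
    obtain rfl : i = Fin.last 0 := Subsingleton.elim (α := Fin 1) _ _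
    rw [Fin.snoc_last, hT, add_zero]
    exact hv
  | succ k ih =>
    obtain ⟨x, hx⟩ := ih (Fin.tail e)
    obtain ⟨v, hv⟩ := hS (e 0 - T (x 0))
    refine ⟨Fin.cons v x, fun i => ?_⟩
    refine Fin.cases ?_ (fun i => ?_) i
    · have h0 : (0 : Fin (k + 2)) = Fin.castSucc 0 := rfl
      rw [Fin.tail_cons, Fin.cons_zero, h0, Fin.snoc_castSucc, hv]
      simp
    · rw [Fin.tail_cons, Fin.cons_succ]
      have := hx i
      refine Eq.trans ?_ this
      congr 2
      refine Fin.lastCases ?_ (fun j => ?_) i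
      · rw [Fin.succ_last, Fin.snoc_last, Fin.snoc_last]
      · rw [Fin.succ_castSucc, Fin.snoc_castSucc, Fin.snoc_castSucc]
        rfl

/-- Against a Jordan block at `α`, only the value of the other pencil at `α` matters. -/
theorem alwaysSolvable_jordan_of_surjective (k : ℕ) (α : ℂ) {A' C' : Matrix ι' κ' ℂ}
    (h : Function.Surjective (evalAt A' C' (α : OnePoint ℂ)).mulVec) :
    AlwaysSolvable (coeffA (.jordan k α)) (coeffC (.jordan k α)) A' C' := by
  intro E
  obtain ⟨x, hx⟩ := exists_backward_recursion (fun v => -(A' - α • C').mulVec v) C'.mulVec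
    (mulVec_zero _) (fun w => by
      obtain ⟨v, hv⟩ := h (-w)
      exact ⟨v, neg_eq_iff_eq_neg.2 hv⟩) k E
  refine ⟨of x, ?_⟩
  change (α • diagOnes (k + 1) (k + 1) + superOnes (k + 1) (k + 1)) * of x * C'ᵀ -
    diagOnes (k + 1) (k + 1) * of x * A'ᵀ = E
  rw [diagOnes_self, Matrix.one_mul]
  funext i
  rw [← hx i]
  have h1 : ((α • (1 : Matrix (Fin (k + 1)) (Fin (k + 1)) ℂ) + superOnes (k + 1) (k + 1)) * of x) i
      = α • x i + Fin.snoc (α := fun _ => κ' → ℂ) (Fin.tail x) 0 i := by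
    rw [Matrix.add_mul, smul_mul, Matrix.one_mul]
    exact congrArg (α • x i + ·) (superOnes_mul_row_snoc k (of x) i)
  refine (congrArg₂ (· - ·) (mul_transpose_row _ C' i) (mul_transpose_row (of x) A' i)).trans ?_
  rw [h1, mulVec_add, mulVec_smul, sub_mulVec, smul_mulVec]
  change α • C'.mulVec (x i) + _ - A'.mulVec (x i) = _
  abel

theorem alwaysSolvable_jordanInf_of_surjective (k : ℕ) {A' C' : Matrix ι' κ' ℂ}
    (h : Function.Surjective C'.mulVec) :
    AlwaysSolvable (coeffA (.jordanInf k)) (coeffC (.jordanInf k)) A' C' := by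
  intro E
  obtain ⟨x, hx⟩ := exists_backward_recursion C'.mulVec (fun v => -A'.mulVec v)
    (by rw [mulVec_zero, neg_zero]) h k E
  refine ⟨of x, ?_⟩
  change diagOnes (k + 1) (k + 1) * of x * C'ᵀ - superOnes (k + 1) (k + 1) * of x * A'ᵀ = E
  rw [diagOnes_self, Matrix.one_mul]
  funext i
  rw [← hx i]
  refine (congrArg₂ (· - ·) (mul_transpose_row (of x) C' i) (mul_transpose_row _ A' i)).trans ?_
  rw [superOnes_mul_row_snoc, sub_eq_add_neg]
  rfl

end Rows

theorem superOnes_transpose_mulVec (k : ℕ) (v : Fin k → ℂ) :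
    (superOnes k (k + 1))ᵀ.mulVec v = Fin.cons (α := fun _ => ℂ) 0 v := by
  ext i
  refine Fin.cases ?_ (fun i => ?_) i
  · simp [mulVec, dotProduct, superOnes]
  · have h : ∀ j : Fin k, ((i : ℕ) = (j : ℕ)) = (i = j) := fun j => by rw [Fin.ext_iff]
    simp [mulVec, dotProduct, superOnes, h]

theorem diagOnes_transpose_mulVec (k : ℕ) (v : Fin k → ℂ) :
    (diagOnes k (k + 1))ᵀ.mulVec v = Fin.snoc (α := fun _ => ℂ) v 0 := by
  ext i
  refine Fin.lastCases ?_ (fun i => ?_) i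
  · have h : ∀ j : Fin k, (k = (j : ℕ)) = False := fun j => by simpa using j.2.ne'
    simp [mulVec, dotProduct, diagOnes, h]
  · have h : ∀ j : Fin k, ((i : ℕ) = (j : ℕ)) = (i = j) := fun j => by rw [Fin.ext_iff]
    simp [mulVec, dotProduct, diagOnes, h]

/-- The equations for `L_ε` and `L_ηᵀ` decouple along the diagonals of `X`. If `ε ≤ η`, no diagonal
is constrained at both of its ends: those below the main diagonal are solved from their upper end,
the others from their lower end. -/
theorem alwaysSolvable_right_left {ε η : ℕ} (h : ε ≤ η) :
    AlwaysSolvable (coeffA (.right ε)) (coeffC (.right ε)) (coeffA (.left η))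
      (coeffC (.left η)) := by
  rw [alwaysSolvable_right_iff]
  intro e
  -- the right-hand side, extended by zero, so that all sums can have a fixed length
  let f : ℕ → ℕ → ℂ := fun i j =>
    if hi : i < ε then if hj : j < η + 1 then e ⟨i, hi⟩ ⟨j, hj⟩ else 0 else 0
  let x : ℕ → ℕ → ℂ := fun i j =>
    if j < i then ∑ t ∈ Finset.range (j + 1), f (i - 1 - t) (j - t)
    else -∑ t ∈ Finset.range ε, f (i + t) (j + 1 + t)
  have hx0 : ∀ i, x (i + 1) 0 = f i 0 := fun i => by simp [x]
  have hxs : ∀ i j, i < ε → x (i + 1) (j + 1) - x i j = f i (j + 1) := by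
    intro i j hi
    by_cases hji : j < i
    · have h1 : j + 1 < i + 1 := by omega
      simp only [x, if_pos hji, if_pos h1]
      rw [Finset.sum_range_succ']
      have : ∀ t, f (i + 1 - 1 - (t + 1)) (j + 1 - (t + 1)) = f (i - 1 - t) (j - t) := fun t => by
        congr 1 <;> omega
      simp only [this]
      exact add_sub_cancel_left _ _
    · have h1 : ¬ j + 1 < i + 1 := by omega
      simp only [x, if_neg hji, if_neg h1]
      have h2 := Finset.sum_range_sub' (fun t => f (i + t) (j + 1 + t)) ε
      rw [Finset.sum_sub_distrib] at h2
      have h3 : f (i + ε) (j + 1 + ε) = 0 := by simp [f]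
      have h4 : ∀ t, f (i + 1 + t) (j + 1 + 1 + t) = f (i + (t + 1)) (j + 1 + (t + 1)) := by
        intro t
        congr 1 <;> omega
      simp only [h3, sub_zero, add_zero] at h2
      simp only [h4]
      rw [← h2]
      ring
  have hxη : ∀ i, i < ε → x (i + 1) η = 0 := by
    intro i hi
    have h1 : ¬ η < i + 1 := by omega
    simp only [x, if_neg h1, neg_eq_zero]
    refine Finset.sum_eq_zero fun t _ => ?_
    have : ¬ η + 1 + t < η + 1 := by omega
    simp only [f, dif_neg this, dite_eq_ite, ite_self]
  refine ⟨fun i j => x i j, fun i => ?_⟩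
  change (diagOnes η (η + 1))ᵀ.mulVec (fun j : Fin η => x i.succ j) -
    (superOnes η (η + 1))ᵀ.mulVec (fun j : Fin η => x i.castSucc j) = e i
  have hsnoc : ∀ j : Fin (η + 1), (Fin.snoc (α := fun _ => ℂ) (fun j : Fin η => x i.succ j) 0 :
      Fin (η + 1) → ℂ) j = x (i + 1) j := fun j => by
    refine Fin.lastCases ?_ (fun j => ?_) j
    · simp [hxη i i.2]
    · simp
  have hf : ∀ j : Fin (η + 1), e i j = f i j := fun j => by
    simp only [f, dif_pos i.2, dif_pos j.2]
    rfl
  rw [superOnes_transpose_mulVec, diagOnes_transpose_mulVec]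
  funext j
  rw [Pi.sub_apply, hsnoc, hf]
  refine Fin.cases ?_ (fun j => ?_) j
  · simp [hx0]
  · simpa using hxs i j i.2

/-- A left singular block has more rows than columns, so it is nowhere surjective. -/
theorem not_surjective_left (η : ℕ) (α : OnePoint ℂ) :
    ¬ Function.Surjective (evalAt (coeffA (.left η)) (coeffC (.left η)) α).mulVec := by
  intro h
  have := card_le_of_mulVec_surjective h
  rw [Fintype.card_fin, Fintype.card_fin] at this
  exact absurd this (Nat.not_succ_le_self η)

theorem not_surjective_superOnes (k : ℕ) :
    ¬ Function.Surjective (superOnes (k + 1) (k + 1)).mulVec := by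
  intro h
  obtain ⟨v, hv⟩ := h 1
  have := congrFun hv (Fin.last k)
  rw [superOnes_mulVec_snoc, Fin.snoc_last] at this
  exact zero_ne_one this

theorem not_surjective_jordan (k : ℕ) (α : ℂ) : ¬ Function.Surjective
    (evalAt (coeffA (.jordan k α)) (coeffC (.jordan k α)) (α : OnePoint ℂ)).mulVec := by
  have h : evalAt (coeffA (.jordan k α)) (coeffC (.jordan k α)) (α : OnePoint ℂ) =
      superOnes (k + 1) (k + 1) :=
    add_sub_cancel_left (α • diagOnes (k + 1) (k + 1)) (superOnes (k + 1) (k + 1))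
  rw [h]
  exact not_surjective_superOnes k

theorem not_surjective_jordanInf (k : ℕ) : ¬ Function.Surjective
    (evalAt (coeffA (.jordanInf k)) (coeffC (.jordanInf k)) OnePoint.infty).mulVec :=
  not_surjective_superOnes k

theorem surjective_diagOnes_self (k : ℕ) : Function.Surjective (diagOnes k k).mulVec := by
  rw [diagOnes_self]
  exact fun v => ⟨v, one_mulVec v⟩

theorem surjective_coeffC_right (ε : ℕ) : Function.Surjective (coeffC (.right ε)).mulVec := fun v =>
  ⟨(Fin.snoc (α := fun _ => ℂ) v 0 : Fin (ε + 1) → ℂ),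
    (diagOnes_mulVec_init ε _).trans (Fin.init_snoc (α := fun _ => ℂ) 0 v)⟩

/-- A block `L_ε` is surjective at every point. At a finite point `μ` this follows from solvability against
the `1 × 1` Jordan block with eigenvalue `μ`. -/
theorem surjective_right (ε : ℕ) (α : OnePoint ℂ) :
    Function.Surjective (evalAt (coeffA (.right ε)) (coeffC (.right ε)) α).mulVec := by
  cases α using OnePoint.rec with
  | infty => exact surjective_coeffC_right ε
  | coe μ =>
    have h := alwaysSolvable_right_of_surjective ε (A' := coeffA (.jordan 0 μ))
      (C' := coeffC (.jordan 0 μ)) (surjective_diagOnes_self 1)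
    exact (h.surjective_or (μ : OnePoint ℂ)).resolve_right (not_surjective_jordan 0 μ)

/-- A block that is not left singular is surjective at all finite points but at most one. -/
theorem exists_forall_ne_surjective {β : KroneckerBlock} (hβ : ∀ η, β ≠ .left η) :
    ∃ γ : ℂ, ∀ μ, μ ≠ γ → Function.Surjective (β.coeffA - μ • β.coeffC).mulVec := by
  cases β with
  | right ε => exact ⟨0, fun μ _ => surjective_right ε μ⟩
  | left η => exact absurd rfl (hβ η)
  | jordan k α =>
    refine ⟨α, fun μ hμ => ?_⟩
    have h : coeffA (.jordan k α) - μ • coeffC (.jordan k α) =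
        (α - μ) • (1 : Matrix (Fin (k + 1)) (Fin (k + 1)) ℂ) + superOnes (k + 1) (k + 1) := by
      change α • diagOnes (k + 1) (k + 1) + superOnes (k + 1) (k + 1) -
        μ • diagOnes (k + 1) (k + 1) = _
      rw [diagOnes_self]
      module
    rw [h]
    exact mulVec_surjective_iff_isUnit.2
      (isUnit_smul_one_add_superOnes (k + 1) (sub_ne_zero.2 hμ.symm))
  | jordanInf k =>
    refine ⟨0, fun μ _ => ?_⟩
    have h : IsUnit (1 - μ • superOnes (k + 1) (k + 1)) :=
      ((isNilpotent_superOnes (k + 1)).smul μ).isUnit_one_sub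
    rw [← diagOnes_self] at h
    exact mulVec_surjective_iff_isUnit.2 h

/-- Two blocks that are not left singular are solvable, unless they share an eigenvalue. -/
theorem alwaysSolvable_or_exists_not_surjective {β γ : KroneckerBlock}
    (hβ : ∀ η, β ≠ .left η) (hγ : ∀ η, γ ≠ .left η) :
    AlwaysSolvable β.coeffA β.coeffC γ.coeffA γ.coeffC ∨ ∃ α : OnePoint ℂ,
      ¬ Function.Surjective (evalAt β.coeffA β.coeffC α).mulVec ∧
      ¬ Function.Surjective (evalAt γ.coeffA γ.coeffC α).mulVec := by
  cases β with
  | left η => exact absurd rfl (hβ η)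
  | jordan k α =>
    by_cases h : Function.Surjective (evalAt γ.coeffA γ.coeffC (α : OnePoint ℂ)).mulVec
    · exact .inl (alwaysSolvable_jordan_of_surjective k α h)
    · exact .inr ⟨α, not_surjective_jordan k α, h⟩
  | jordanInf k =>
    by_cases h : Function.Surjective γ.coeffC.mulVec
    · exact .inl (alwaysSolvable_jordanInf_of_surjective k h)
    · exact .inr ⟨OnePoint.infty, not_surjective_jordanInf k, h⟩
  | right ε =>
    left
    cases γ with
    | left η => exact absurd rfl (hγ η)
    | right ε' => exact alwaysSolvable_right_of_surjective ε (surjective_coeffC_right ε')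
    | jordan k α => exact alwaysSolvable_right_of_surjective ε (surjective_diagOnes_self (k + 1))
    | jordanInf k =>
      exact (alwaysSolvable_jordanInf_of_surjective k (surjective_coeffC_right ε)).swap

/-- A left singular block `L_ηᵀ` is only solvable against the blocks `L_ε` with `ε ≤ η`. -/
theorem alwaysSolvable_left_iff {η : ℕ} {γ : KroneckerBlock} :
    AlwaysSolvable (coeffA (.left η)) (coeffC (.left η)) γ.coeffA γ.coeffC ↔
      ∃ ε ≤ η, γ = .right ε := by
  constructor
  · intro h
    have hsurj := fun α => (h.surjective_or α).resolve_left (not_surjective_left η α)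
    cases γ with
    | left η' => exact absurd (hsurj OnePoint.infty) (not_surjective_left η' _)
    | jordan k α => exact absurd (hsurj α) (not_surjective_jordan k α)
    | jordanInf k => exact absurd (hsurj OnePoint.infty) (not_surjective_jordanInf k)
    | right ε =>
      have hc := h.card_le
      simp only [Fintype.card_fin] at hc
      change ε * (η + 1) ≤ (ε + 1) * η at hc
      refine ⟨ε, ?_, rfl⟩
      rw [Nat.mul_succ, Nat.succ_mul] at hc
      omega
  · rintro ⟨ε, hε, rfl⟩
    exact (alwaysSolvable_right_left hε).swap

/-! ### The three criteria -/

section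

variable {ι κ ι' κ' : Type} [Fintype ι] [DecidableEq ι] [Fintype κ] [DecidableEq κ]
  [Fintype ι'] [DecidableEq ι'] [Fintype κ'] [DecidableEq κ']
  {A C : Matrix ι κ ℂ} {A' C' : Matrix ι' κ' ℂ}

/-- Without left singular blocks, a pencil is surjective at all but finitely many finite points. -/
theorem IsKCF.exists_surjective {k : ℕ} {b : Fin k → KroneckerBlock} (h : IsKCF A C b)
    (hb : ∀ i η, b i ≠ .left η) : ∃ μ : ℂ, Function.Surjective (A - μ • C).mulVec := by
  choose γ hγ using fun i => exists_forall_ne_surjective (hb i)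
  obtain ⟨μ, hμ⟩ := Infinite.exists_notMem_finset (Finset.univ.image γ)
  refine ⟨μ, (surjective_evalAt_iff_blocks h (μ : OnePoint ℂ)).2 fun i => hγ i μ ?_⟩
  rintro rfl
  exact hμ (Finset.mem_image_of_mem γ (Finset.mem_univ i))

theorem AlwaysSolvable.kcfIsSumOf (h : AlwaysSolvable A C A' C') {η : ℕ}
    (hη : KCFContains A C (.left η)) : KCFIsSumOf A' C' {β | ∃ ε ≤ η, β = .right ε} := by
  obtain ⟨k, b, hb, i, hi⟩ := hη
  obtain ⟨l, b', hb'⟩ := exists_isKCF A' C'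
  refine ⟨l, b', hb', fun j => ?_⟩
  have := (alwaysSolvable_iff_blocks hb hb').1 h i j
  rw [hi] at this
  exact alwaysSolvable_left_iff.1 this

/-- It suffices to treat the smallest block `L_ηᵀ`: it bounds all the blocks `L_ε` of the other
pencil. -/
theorem alwaysSolvable_of_kcfContains_left
    (h : ∀ η, KCFContains A C (.left η) → KCFIsSumOf A' C' {β | ∃ ε ≤ η, β = .right ε})
    (hη : ∃ η, KCFContains A C (.left η)) : AlwaysSolvable A C A' C' := by
  classical
  obtain ⟨l, b', hb', hr⟩ := h _ (Nat.find_spec hη)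
  obtain ⟨k, b, hb⟩ := exists_isKCF A C
  rw [alwaysSolvable_iff_blocks hb hb']
  intro i j
  obtain ⟨ε, hε, hj⟩ := hr j
  by_cases hi : ∃ η, b i = .left η
  · obtain ⟨η, hi⟩ := hi
    rw [hi]
    exact alwaysSolvable_left_iff.2
      ⟨ε, hε.trans (Nat.find_min' hη ⟨k, b, hb, i, hi⟩), hj⟩
  · push Not at hi
    rw [hj]
    exact (alwaysSolvable_or_exists_not_surjective hi fun η => by simp).resolve_right
      fun ⟨α, _, hα⟩ => hα (surjective_right ε α)

/-- The criterion for the solvability of the generalized Sylvester equation. -/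
theorem alwaysSolvable_iff : AlwaysSolvable A C A' C' ↔
    NoCommonEigenvalue A C A' C' ∧ ∀ η : ℕ,
      (KCFContains A C (.left η) → KCFIsSumOf A' C' {β | ∃ ε ≤ η, β = .right ε}) ∧
      (KCFContains A' C' (.left η) → KCFIsSumOf A C {β | ∃ ε ≤ η, β = .right ε}) := by
  constructor
  · exact fun h => ⟨h.noCommonEigenvalue, fun η => ⟨h.kcfIsSumOf, h.swap.kcfIsSumOf⟩⟩
  · rintro ⟨hno, h⟩
    by_cases h1 : ∃ η, KCFContains A C (.left η)
    · exact alwaysSolvable_of_kcfContains_left (fun η => (h η).1) h1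
    by_cases h2 : ∃ η, KCFContains A' C' (.left η)
    · exact (alwaysSolvable_of_kcfContains_left (fun η => (h η).2) h2).swap
    obtain ⟨k, b, hb⟩ := exists_isKCF A C
    obtain ⟨l, b', hb'⟩ := exists_isKCF A' C'
    have hl : ∀ i η, b i ≠ .left η := fun i η hi => h1 ⟨η, k, b, hb, i, hi⟩
    have hl' : ∀ i η, b' i ≠ .left η := fun i η hi => h2 ⟨η, l, b', hb', i, hi⟩
    obtain ⟨μ, hμ⟩ := hb.exists_surjective hl
    obtain ⟨μ', hμ'⟩ := hb'.exists_surjective hl'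
    rw [alwaysSolvable_iff_blocks hb hb']
    intro i j
    refine (alwaysSolvable_or_exists_not_surjective (hl i) (hl' j)).resolve_right ?_
    rintro ⟨α, hα, hα'⟩
    exact hno α
      ⟨isEigenvalue_of_not_surjective hμ fun hs =>
        hα ((surjective_evalAt_iff_blocks hb α).1 hs i),
      isEigenvalue_of_not_surjective hμ' fun hs =>
        hα' ((surjective_evalAt_iff_blocks hb' α).1 hs j)⟩

/-- The criterion for uniqueness is that for solvability, applied to the transposed pencils. -/
theorem alwaysSolvable_transpose_iff : AlwaysSolvable Aᵀ Cᵀ A'ᵀ C'ᵀ ↔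
    NoCommonEigenvalue A C A' C' ∧ ∀ ε : ℕ,
      (KCFContains A C (.right ε) → KCFIsSumOf A' C' {β | ∃ η ≤ ε, β = .left η}) ∧
      (KCFContains A' C' (.right ε) → KCFIsSumOf A C {β | ∃ η ≤ ε, β = .left η}) := by
  have hset : ∀ n : ℕ, {β : KroneckerBlock | β.transpose ∈ {β | ∃ ε ≤ n, β = .right ε}} =
      {β | ∃ η ≤ n, β = .left η} := by
    intro n
    ext β
    refine exists_congr fun ε => and_congr_right fun _ => ⟨fun h => ?_, fun h => by rw [h]; rfl⟩
    rw [← β.transpose_transpose, h]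
    rfl
  rw [alwaysSolvable_iff]
  simp only [NoCommonEigenvalue, isEigenvalue_transpose_iff, kcfContains_transpose_iff,
    kcfIsSumOf_transpose_iff, hset]
  rfl

/-- If the equation for two blocks is always uniquely solvable, then the blocks are `L_s` and
`L_sᵀ` for the same `s`, or both are square, that is, Jordan blocks. -/
theorem alwaysSolvable_and_transpose {β γ : KroneckerBlock}
    (h : AlwaysSolvable β.coeffA β.coeffC γ.coeffA γ.coeffC)
    (ht : AlwaysSolvable β.transpose.coeffA β.transpose.coeffC γ.transpose.coeffA
      γ.transpose.coeffC) :
    (∃ s, β = .right s ∧ γ = .left s) ∨ (∃ s, β = .left s ∧ γ = .right s) ∨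
      (β.rows = β.cols ∧ γ.rows = γ.cols) := by
  have key : ∀ {s : ℕ} {γ : KroneckerBlock},
      AlwaysSolvable (coeffA (.left s)) (coeffC (.left s)) γ.coeffA γ.coeffC →
      AlwaysSolvable (coeffA (.right s)) (coeffC (.right s)) γ.transpose.coeffA
        γ.transpose.coeffC → γ = .right s := by
    intro s γ h ht
    obtain ⟨ε, hε, rfl⟩ := alwaysSolvable_left_iff.1 h
    obtain ⟨ε', hε', h'⟩ := alwaysSolvable_left_iff.1 ht.swap
    obtain rfl : s = ε' := by injection h'
    rw [le_antisymm hε hε']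
  have key' : ∀ {s : ℕ} {γ : KroneckerBlock},
      AlwaysSolvable (coeffA (.right s)) (coeffC (.right s)) γ.coeffA γ.coeffC →
      AlwaysSolvable (coeffA (.left s)) (coeffC (.left s)) γ.transpose.coeffA
        γ.transpose.coeffC → γ = .left s := by
    intro s γ h ht
    have := key ht (by rwa [KroneckerBlock.transpose_transpose])
    rw [← γ.transpose_transpose, this]
    rfl
  cases β with
  | left s => exact .inr (.inl ⟨s, rfl, key h ht⟩)
  | right s => exact .inl ⟨s, rfl, key' h ht⟩
  | jordan k α =>
    cases γ with
    | left s => exact absurd (key h.swap ht.swap) (by simp)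
    | right s => exact absurd (key' h.swap ht.swap) (by simp)
    | jordan l β => exact .inr (.inr ⟨rfl, rfl⟩)
    | jordanInf l => exact .inr (.inr ⟨rfl, rfl⟩)
  | jordanInf k =>
    cases γ with
    | left s => exact absurd (key h.swap ht.swap) (by simp)
    | right s => exact absurd (key' h.swap ht.swap) (by simp)
    | jordan l β => exact .inr (.inr ⟨rfl, rfl⟩)
    | jordanInf l => exact .inr (.inr ⟨rfl, rfl⟩)

theorem IsKCF.exists_rows_pos [Nonempty ι] {k : ℕ} {b : Fin k → KroneckerBlock}
    (h : IsKCF A C b) : ∃ i, 0 < (b i).rows := by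
  obtain ⟨e, -⟩ := h
  obtain ⟨i, x⟩ := e (Classical.arbitrary ι)
  exact ⟨i, x.pos⟩

end

/-- A pencil is regular if and only if it is square and invertible at some point. -/
theorem isRegular_iff {p m : ℕ} {A C : Matrix (Fin p) (Fin m) ℂ} :
    IsRegular A C ↔ p = m ∧ ∃ μ : ℂ, Function.Surjective (A - μ • C).mulVec := by
  refine ⟨fun ⟨h, hd⟩ => ⟨h, ?_⟩, fun ⟨h, μ, hμ⟩ => ⟨h, ?_⟩⟩
  all_goals
    subst h
    have hdet : ∀ μ : ℂ, ((polyMatrix A C).submatrix id (finCongr rfl)).det.eval μ =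
        (A - μ • C).det := fun μ => by
      rw [← Polynomial.coe_evalRingHom, RingHom.map_det]
      congr 1
      ext i j
      simp only [RingHom.mapMatrix_apply, Matrix.map_apply, submatrix_apply, polyMatrix, of_apply,
        Polynomial.coe_evalRingHom, Polynomial.eval_sub, Polynomial.eval_C, Polynomial.eval_mul,
        Polynomial.eval_X]
      rfl
  · have : ∃ μ, ((polyMatrix A C).submatrix id (finCongr rfl)).det.eval μ ≠ 0 := by
      by_contra hcon
      push Not at hcon
      exact hd (Polynomial.funext fun μ => by rw [hcon μ, Polynomial.eval_zero])
    obtain ⟨μ, hμ⟩ := this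
    rw [hdet] at hμ
    exact ⟨μ, mulVec_surjective_iff_isUnit.2 ((isUnit_iff_isUnit_det _).2 hμ.isUnit)⟩
  · intro h0
    have := ((isUnit_iff_isUnit_det _).1 (mulVec_surjective_iff_isUnit.1 hμ)).ne_zero
    rw [← hdet, h0, Polynomial.eval_zero] at this
    exact this rfl

/-- A direct sum of square, that is, of Jordan blocks is regular. -/
theorem IsKCF.isRegular {p m : ℕ} {A C : Matrix (Fin p) (Fin m) ℂ} {k : ℕ}
    {b : Fin k → KroneckerBlock} (h : IsKCF A C b) (hb : ∀ i, (b i).rows = (b i).cols) :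
    IsRegular A C := by
  rw [isRegular_iff]
  constructor
  · obtain ⟨e, f, -⟩ := h
    have he := Fintype.card_congr e
    have hf := Fintype.card_congr f
    simp only [Fintype.card_sigma, Fintype.card_fin] at he hf
    rw [he, hf]
    exact Finset.sum_congr rfl fun i _ => hb i
  · refine h.exists_surjective fun i η hi => ?_
    have := hb i
    rw [hi] at this
    exact absurd this (Nat.succ_ne_self η)

theorem IsRegular.not_kcfContains_left {p m : ℕ} {A C : Matrix (Fin p) (Fin m) ℂ}
    (h : IsRegular A C) (η : ℕ) : ¬ KCFContains A C (.left η) := by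
  rintro ⟨k, b, hb, i, hi⟩
  obtain ⟨-, μ, hμ⟩ := isRegular_iff.1 h
  have := (surjective_evalAt_iff_blocks hb (μ : OnePoint ℂ)).1 hμ i
  rw [hi] at this
  exact not_surjective_left η _ this

theorem IsRegular.transpose {p m : ℕ} {A C : Matrix (Fin p) (Fin m) ℂ}
    (h : IsRegular A C) : IsRegular Aᵀ Cᵀ := by
  obtain ⟨rfl, μ, hμ⟩ := isRegular_iff.1 h
  refine isRegular_iff.2 ⟨rfl, μ, ?_⟩
  rw [← transpose_smul, ← transpose_sub, ← mulVec_injective_iff_transpose_surjective]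
  rw [mulVec_surjective_iff_isUnit] at hμ
  exact mulVec_injective_iff_isUnit.2 hμ

theorem IsRegular.not_kcfContains_right {p m : ℕ} {A C : Matrix (Fin p) (Fin m) ℂ}
    (h : IsRegular A C) (ε : ℕ) : ¬ KCFContains A C (.right ε) := fun h' =>
  h.transpose.not_kcfContains_left ε (kcfContains_transpose_iff.2 h')

section

variable {p m q n : ℕ} {A C : Matrix (Fin p) (Fin m) ℂ} {A' C' : Matrix (Fin q) (Fin n) ℂ}

theorem alwaysSolvable_of_right_left {s : ℕ} (h : KCFIsSumOf A C {.right s})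
    (h' : KCFIsSumOf A' C' {.left s}) :
    AlwaysSolvable A C A' C' ∧ AlwaysSolvable Aᵀ Cᵀ A'ᵀ C'ᵀ := by
  obtain ⟨k, b, hb, hr⟩ := h
  obtain ⟨l, b', hb', hl⟩ := h'
  constructor
  · rw [alwaysSolvable_iff_blocks hb hb']
    intro i j
    rw [hr i, hl j]
    exact alwaysSolvable_right_left le_rfl
  · rw [alwaysSolvable_iff_blocks hb.transpose hb'.transpose]
    intro i j
    rw [hr i, hl j]
    exact (alwaysSolvable_right_left le_rfl).swap

/-- The criterion for unique solvability. -/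
theorem alwaysSolvable_and_transpose_iff (hp : 0 < p) (hq : 0 < q) :
    AlwaysSolvable A C A' C' ∧ AlwaysSolvable Aᵀ Cᵀ A'ᵀ C'ᵀ ↔
      ((IsRegular A C ∧ IsRegular A' C' ∧ NoCommonEigenvalue A C A' C') ∨
        ∃ s : ℕ, 0 < s ∧ ((KCFIsSumOf A C {.right s} ∧ KCFIsSumOf A' C' {.left s}) ∨
          (KCFIsSumOf A' C' {.right s} ∧ KCFIsSumOf A C {.left s}))) := by
  constructor
  · rintro ⟨h, ht⟩
    obtain ⟨k, b, hb⟩ := exists_isKCF A C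
    obtain ⟨l, b', hb'⟩ := exists_isKCF A' C'
    have := Fin.pos_iff_nonempty.1 hp
    have := Fin.pos_iff_nonempty.1 hq
    have hpair := fun i j => alwaysSolvable_and_transpose
      ((alwaysSolvable_iff_blocks hb hb').1 h i j)
      ((alwaysSolvable_iff_blocks hb.transpose hb'.transpose).1 ht i j)
    -- as `p, q > 0`, there are blocks with rows, which excludes `s = 0`
    obtain ⟨i₀, hi₀⟩ := hb.exists_rows_pos
    obtain ⟨j₀, hj₀⟩ := hb'.exists_rows_pos
    rcases hpair i₀ j₀ with ⟨s, hi, hj⟩ | ⟨s, hi, hj⟩ | ⟨hi, hj⟩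
    · rw [hi] at hi₀
      have hall' : ∀ j, b' j = .left s := fun j => by
        have := hpair i₀ j
        rw [hi] at this
        simpa [rows, cols] using this
      have hall : ∀ i, b i = .right s := fun i => by
        have := hpair i j₀
        rw [hj] at this
        simpa [rows, cols] using this
      exact .inr ⟨s, hi₀, .inl ⟨⟨k, b, hb, hall⟩, ⟨l, b', hb', hall'⟩⟩⟩
    · rw [hj] at hj₀
      have hall' : ∀ j, b' j = .right s := fun j => by
        have := hpair i₀ j
        rw [hi] at this
        simpa [rows, cols] using this
      have hall : ∀ i, b i = .left s := fun i => by
        have := hpair i j₀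
        rw [hj] at this
        simpa [rows, cols] using this
      exact .inr ⟨s, hj₀, .inr ⟨⟨l, b', hb', hall'⟩, ⟨k, b, hb, hall⟩⟩⟩
    · have hall' : ∀ j, (b' j).rows = (b' j).cols := fun j => by
        rcases hpair i₀ j with ⟨s, hi', -⟩ | ⟨s, hi', -⟩ | ⟨-, hj'⟩
        · rw [hi'] at hi; simp [rows, cols] at hi
        · rw [hi'] at hi; simp [rows, cols] at hi
        · exact hj'
      have hall : ∀ i, (b i).rows = (b i).cols := fun i => by
        rcases hpair i j₀ with ⟨s, -, hj'⟩ | ⟨s, -, hj'⟩ | ⟨hi', -⟩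
        · rw [hj'] at hj; simp [rows, cols] at hj
        · rw [hj'] at hj; simp [rows, cols] at hj
        · exact hi'
      exact .inl ⟨hb.isRegular hall, hb'.isRegular hall', h.noCommonEigenvalue⟩
  · rintro (⟨h, h', hno⟩ | ⟨s, -, ⟨h, h'⟩ | ⟨h', h⟩⟩)
    · exact ⟨alwaysSolvable_iff.2 ⟨hno, fun η =>
          ⟨fun hc => absurd hc (h.not_kcfContains_left η),
            fun hc => absurd hc (h'.not_kcfContains_left η)⟩⟩,
        alwaysSolvable_transpose_iff.2 ⟨hno, fun ε =>
          ⟨fun hc => absurd hc (h.not_kcfContains_right ε),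
            fun hc => absurd hc (h'.not_kcfContains_right ε)⟩⟩⟩
    · exact alwaysSolvable_of_right_left h h'
    · exact (alwaysSolvable_of_right_left h' h).imp .swap .swap

end

end MatrixPencil

theorem mainTheorem4 {p m n q : ℕ} (hp : 0 < p) (hm : 0 < m) (hn : 0 < n) (hq : 0 < q)
    (A C : Matrix (Fin p) (Fin m) ℂ) (B D : Matrix (Fin n) (Fin q) ℂ) :
    -- at least one solution for every right-hand side
    ((∀ E : Matrix (Fin p) (Fin q) ℂ, ∃ X : Matrix (Fin m) (Fin n) ℂ,
        A * X * B - C * X * D = E) ↔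
      (MatrixPencil.NoCommonEigenvalue A C D.transpose B.transpose ∧
        ∀ η : ℕ,
          (MatrixPencil.KCFContains A C (.left η) →
            MatrixPencil.KCFIsSumOf D.transpose B.transpose {β | ∃ ε ≤ η, β = .right ε}) ∧
          (MatrixPencil.KCFContains D.transpose B.transpose (.left η) →
            MatrixPencil.KCFIsSumOf A C {β | ∃ ε ≤ η, β = .right ε}))) ∧
    -- at most one solution for every right-hand side
    ((∀ (E : Matrix (Fin p) (Fin q) ℂ) (X Y : Matrix (Fin m) (Fin n) ℂ),
        A * X * B - C * X * D = E → A * Y * B - C * Y * D = E → X = Y) ↔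
      (MatrixPencil.NoCommonEigenvalue A C D.transpose B.transpose ∧
        ∀ ε : ℕ,
          (MatrixPencil.KCFContains A C (.right ε) →
            MatrixPencil.KCFIsSumOf D.transpose B.transpose {β | ∃ η ≤ ε, β = .left η}) ∧
          (MatrixPencil.KCFContains D.transpose B.transpose (.right ε) →
            MatrixPencil.KCFIsSumOf A C {β | ∃ η ≤ ε, β = .left η}))) ∧
    -- exactly one solution for every right-hand side
    ((∀ E : Matrix (Fin p) (Fin q) ℂ, ∃! X : Matrix (Fin m) (Fin n) ℂ,
        A * X * B - C * X * D = E) ↔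
      ((MatrixPencil.IsRegular A C ∧ MatrixPencil.IsRegular D.transpose B.transpose ∧
          MatrixPencil.NoCommonEigenvalue A C D.transpose B.transpose) ∨
        ∃ s : ℕ, 0 < s ∧
          ((MatrixPencil.KCFIsSumOf A C {.right s} ∧
              MatrixPencil.KCFIsSumOf D.transpose B.transpose {.left s}) ∨
            (MatrixPencil.KCFIsSumOf D.transpose B.transpose {.right s} ∧
              MatrixPencil.KCFIsSumOf A C {.left s})))) := by
  have hT : ∀ X : Matrix (Fin m) (Fin n) ℂ, A * X * B - C * X * D =
      A * X * B.transpose.transpose - C * X * D.transpose.transpose := fun X => by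
    rw [Matrix.transpose_transpose, Matrix.transpose_transpose]
  have hsurj : (∀ E : Matrix (Fin p) (Fin q) ℂ, ∃ X : Matrix (Fin m) (Fin n) ℂ,
      A * X * B - C * X * D = E) ↔
      MatrixPencil.AlwaysSolvable A C D.transpose B.transpose := by
    simp only [hT]
    rfl
  have hinj : (∀ (E : Matrix (Fin p) (Fin q) ℂ) (X Y : Matrix (Fin m) (Fin n) ℂ),
      A * X * B - C * X * D = E → A * Y * B - C * Y * D = E → X = Y) ↔
      MatrixPencil.AlwaysSolvable A.transpose C.transpose D.transpose.transpose
        B.transpose.transpose := by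
    rw [← MatrixPencil.injective_iff_alwaysSolvable_transpose]
    simp only [hT]
    exact ⟨fun h X Y hXY => h _ X Y hXY rfl, fun h E X Y hX hY => h (hX.trans hY.symm)⟩
  refine ⟨hsurj.trans MatrixPencil.alwaysSolvable_iff,
    hinj.trans MatrixPencil.alwaysSolvable_transpose_iff,
    Iff.trans ?_ (MatrixPencil.alwaysSolvable_and_transpose_iff hp hq)⟩
  rw [← hsurj, ← hinj]
  constructor
  · exact fun h => ⟨fun E => (h E).exists, fun E X Y hX hY => (h E).unique hX hY⟩
  · rintro ⟨h1, h2⟩ E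
    obtain ⟨X, hX⟩ := h1 E
    exact ⟨X, hX, fun Y hY => h2 E Y X hY hX⟩
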